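/- Let $d\ge 1$, $D=[0,1]^d$, $q\in(0,1]$, $\beta>1$ and $M>0$. For a real-valued, centered, square-integrable, (jointly) measurable Gaussian process $u$ on $D$, let $k(x,y)=\mathbb{E}[u(x)u(y)]$ be its covariance function and $\mathcal{C}:L^2(D)\to L^2(D)$, $(\mathcal{C}\psi)(x)=\int_D k(x,y)\psi(y)\,dy$, its covariance operator; write $u\sim \mathrm{GP}(0,\mathcal{C})$. Let $\|k\|_q^q=\sup_{x\in D}\int_D|k(x,y)|^q\,dy$ and $\|k\|_\infty=\sup_{x,y\in D}|k(x,y)|$, and, with $\|\cdot\|$ the operator norm on $L^2(D)$, define the $L^q$-sparsity and the capacity $$\Gamma_1(q,\mathcal{C})=\frac{\|k\|_q^q\,\|k\|_\infty^{1-q}}{\|\mathcal{C}\|},\qquad \Gamma_2(\mathcal{C})=\frac{\mathbb{E}_{u\sim \mathrm{GP}(0,\mathcal{C})}[\sup_{x\in D}u(x)]}{\sqrt{\|k\|_\infty}} .$$ For real numbers $\Gamma_1(q),\Gamma_2$ let $\mathcal{F}(\Gamma_1(q),\Gamma_2)$ be the class of all such processes (identified below with their covariance operators) with $\mathcal{C}\neq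 0$, $\|k\|_\infty<\infty$, $\sup_{x\in D} u(x)$ almost surely finite and integrable, $\Gamma_1(q,\mathcal{C})\le\Gamma_1(q)$ and $\Gamma_2(\mathcal{C})\le\Gamma_2$. There is a constant $c>0$, depending only on $d,q,\beta,M$, such that for all $N\in\mathbb{N}$ and all real $\Gamma_1(q),\Gamma_2$ with $$1\le N^\beta\le \Big\lfloor e^{\Gamma_2^2/2}\Big\rfloor-1,\qquad \Gamma_2\ge 2,\qquad 1\le \Gamma_1(q)\le M N^{(1-q)/2}\,\Gamma_2^{-3+q},$$ the minimax relative operator-norm risk satisfies $$\inf_{\hat{\mathcal{C}}}\ \sup_{\mathcal{C}\in\mathcal{F}(\Gamma_1(q),\Gamma_2)}\frac{\mathbb{E}\|\hat{\mathcal{C}}-\mathcal{C}\|}{\|\mathcal{C}\|}\ \ge\ c\,\Gamma_1(q)\left(\frac{\Gamma_2}{\sqrt N}\right)^{1-q},$$ where the infimum is over all estimators $\hat{\mathcal{C}}$, i.e. all maps from $N$ full sample paths $u_1,\dots,u_N$ to bounded operators on $L^2(D)$ that are (strongly) measurable under every model of the class, and the expectation is over $N$ independent copies $u_1,\dots,u_N$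 of $u\sim\mathrm{GP}(0,\mathcal{C})$. -/

import Mathlib

open MeasureTheory ProbabilityTheory
open scoped ENNReal

noncomputable section

/-- The domain `D = [0,1]^d`; its canonical measure `volume` is Lebesgue measure on the cube. -/
abbrev Cube (d : ℕ) : Type := Fin d → unitInterval

/-- The real Hilbert space `L²(D)`. -/
abbrev L2Cube (d : ℕ) : Type := Lp ℝ 2 (volume : Measure (Cube d))

/-- A real-valued, centered, square-integrable Gaussian process on `D = [0,1]^d`, jointly
measurable in the space variable and the random outcome. -/
structure GaussianModel (d : ℕ) where
  /-- sample space -/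
  Ω : Type
  [measurableSpace : MeasurableSpace Ω]
  /-- probability -/
  P : Measure Ω
  [isProbabilityMeasure : IsProbabilityMeasure P]
  /-- the process -/
  u : Cube d → Ω → ℝ
  measurable_u : Measurable (Function.uncurry u)
  gaussian : IsGaussianProcess u P
  centered : ∀ x, ∫ ω, u x ω ∂P = 0
  squareIntegrable : MemLp (Function.uncurry u) 2 (volume.prod P)

attribute [instance] GaussianModel.measurableSpace GaussianModel.isProbabilityMeasure

/-- `C` is the integral operator on `L²(D)` with kernel `k`: `(Cψ)(x) = ∫_D k(x,y) ψ(y) dy`. -/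
def IsIntegralOperator {d : ℕ} (k : Cube d → Cube d → ℝ) (C : L2Cube d →L[ℝ] L2Cube d) : Prop :=
  ∀ ψ : L2Cube d, ∀ᵐ x : Cube d, C ψ x = ∫ y : Cube d, k x y * ψ y

/-- An integral operator is determined by its kernel. -/
theorem IsIntegralOperator.unique {d : ℕ} {k : Cube d → Cube d → ℝ}
    {C C' : L2Cube d →L[ℝ] L2Cube d} (h : IsIntegralOperator k C) (h' : IsIntegralOperator k C') :
    C = C' := by
  ext1 ψ
  apply Lp.ext
  filter_upwards [h ψ, h' ψ] with x hx hx'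
  rw [hx, hx']

open Classical in
/-- The integral operator on `L²(D)` with kernel `k` (with the value `0` if `k` does not define a
bounded operator). -/
def integralOperator {d : ℕ} (k : Cube d → Cube d → ℝ) : L2Cube d →L[ℝ] L2Cube d :=
  if h : ∃ C, IsIntegralOperator k C then h.choose else 0

/-- `‖k‖_q^q = sup_{x ∈ D} ∫_D |k(x,y)|^q dy`. -/
def kernelLq {d : ℕ} (q : ℝ) (k : Cube d → Cube d → ℝ) : ℝ≥0∞ :=
  ⨆ x : Cube d, ∫⁻ y : Cube d, ‖k x y‖ₑ ^ q

/-- `‖k‖_∞ = sup_{x,y ∈ D} |k(x,y)|`. -/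
def kernelSup {d : ℕ} (k : Cube d → Cube d → ℝ) : ℝ≥0∞ :=
  ⨆ (x : Cube d) (y : Cube d), ‖k x y‖ₑ

namespace GaussianModel

variable {d : ℕ} (m : GaussianModel d)

/-- The covariance function `k(x,y) = E[u(x) u(y)]`. -/
def kernel (x y : Cube d) : ℝ := ∫ ω, m.u x ω * m.u y ω ∂m.P

/-- The covariance operator of the process. -/
def covOp : L2Cube d →L[ℝ] L2Cube d := integralOperator m.kernel

open Classical in
/-- `E[sup_{x ∈ D} u(x)]`, with the value `∞` if the supremum is not almost surely finite or not
integrable. (When it is defined, it is nonnegative, because the process is centered.) -/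
def expectedSup : ℝ≥0∞ :=
  if (∀ᵐ ω ∂m.P, BddAbove (Set.range fun x => m.u x ω)) ∧
      Integrable (fun ω => ⨆ x, m.u x ω) m.P then
    ENNReal.ofReal (∫ ω, ⨆ x, m.u x ω ∂m.P)
  else ∞

/-- The `L^q`-sparsity `Γ₁(q, C) = ‖k‖_q^q ‖k‖_∞^{1-q} / ‖C‖`. -/
def sparsity (q : ℝ) : ℝ≥0∞ :=
  kernelLq q m.kernel * kernelSup m.kernel ^ (1 - q) / ‖m.covOp‖ₑ

/-- The capacity `Γ₂(C) = E[sup_{x ∈ D} u(x)] / √‖k‖_∞`. -/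
def capacity : ℝ≥0∞ := m.expectedSup / kernelSup m.kernel ^ (1 / 2 : ℝ)

end GaussianModel

/-- The approximate sparsity class `F(Γ₁(q), Γ₂)`. The two nondegeneracy conditions, nonzero
covariance operator and bounded kernel, are those under which sparsity, capacity and relative error
are meaningful. -/
def sparseClass (d : ℕ) (q Γ₁ Γ₂ : ℝ) : Set (GaussianModel d) :=
  {m | m.covOp ≠ 0 ∧ kernelSup m.kernel ≠ ∞ ∧
    m.sparsity q ≤ ENNReal.ofReal Γ₁ ∧ m.capacity ≤ ENNReal.ofReal Γ₂}

/-- The data: `N` independent copies of the process, i.e. `N` sample paths evaluated at an outcome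
of the `N`-fold product of the sample space. -/
def GaussianModel.data {d : ℕ} (m : GaussianModel d) (N : ℕ) (ω : Fin N → m.Ω) :
    Fin N → Cube d → ℝ :=
  fun n x => m.u x (ω n)

/-- The law of `N` independent outcomes. -/
def GaussianModel.dataLaw {d : ℕ} (m : GaussianModel d) (N : ℕ) : Measure (Fin N → m.Ω) :=
  Measure.pi fun _ => m.P

/-- Estimators over the class `F`: all maps from `N` full sample paths to bounded operators on
`L²(D)` which are (strongly) measurable under every model of the class. -/
def IsEstimator {d N : ℕ} (F : Set (GaussianModel d))
    (T : (Fin N → Cube d → ℝ) → (L2Cube d →L[ℝ] L2Cube d)) : Prop :=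
  ∀ m ∈ F, ∀ ψ : L2Cube d, AEStronglyMeasurable (fun ω => T (m.data N ω) ψ) (m.dataLaw N)

/-- The relative operator-norm risk `E‖Ĉ - C‖ / ‖C‖`. -/
def relativeRisk {d N : ℕ} (T : (Fin N → Cube d → ℝ) → (L2Cube d →L[ℝ] L2Cube d))
    (m : GaussianModel d) : ℝ≥0∞ :=
  (∫⁻ ω, ‖T (m.data N ω) - m.covOp‖ₑ ∂m.dataLaw N) / ‖m.covOp‖ₑ

/-- The minimax relative operator-norm risk over the class `F` from `N` observations. -/
def minimaxRisk {d : ℕ} (N : ℕ) (F : Set (GaussianModel d)) : ℝ≥0∞ :=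
  ⨅ (T : (Fin N → Cube d → ℝ) → (L2Cube d →L[ℝ] L2Cube d)) (_ : IsEstimator F T),
    ⨆ m ∈ F, relativeRisk T m

end

/-!
The lower bound is a Bayes risk over a random family of covariance operators of Gaussian processes
that are constant on the cells of a partition of the cube. Besides one distinguished cell, which is
independent of all others, there are `kB` "row" cells and `kB` "column" cells; the columns come in
`k` blocks of `B`. Every row `i` carries a switch `γ i` and a selection `l i` of one column in each
block; a row that is switched on has correlation `τ` with its `k` selected columns, and all other
correlations vanish. No column is selected by more than `2k` rows (`balanced`). As `2kτ ≤ 1/2`, the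
correlation matrix is a small perturbation of the identity.

*The models lie in the class.* All cells have volume `w`, except that the distinguished one has
volume `4w`. By Schur's test the operator norm is therefore exactly `4w`, whatever the design is
(`norm_covOp_designModel`); this makes the relative risk an absolute one and bounds the sparsity
by the maximum of `1` and `(1 + 2kτ^q) / 4`. The capacity is at most `Γ₂` because the process takes
at most `exp (Γ₂ ^ 2 / 2)` different values (`integral_iSup_multivariateGaussian_le`). Together this
is `designModel_mem_sparseClass`.

*Estimating the operator means finding the switches.* Pair `T - C` with the indicators of the row
cells and with the sum of the indicators of the column cells: the pairing of `C` with row `i` is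
`w² kτ` or `0` according to `γ i`, and the sum over `i` of the errors in these values is at most
`kBw ‖T - C‖` (`sum_abs_inner_le`).

*The switches cannot be found.* Fix all rows but `i`. Switching row `i` on multiplies the Gaussian
law by the likelihood ratio of a regression of coordinate `i` on the others
(`multivariateGaussian_link_eq_withDensity`). The product of two such ratios, with regression
vectors `b`, `b'` and covariances `v = Q b`, has mean `1 / (1 - b' ⬝ v)`
(`lintegral_linkDensity_mul`). Raised to the `N`-th power and averaged over two independent random
selections, this is at most `χ = exp ((2k / B) exp (4Nτ²))` (`sum_exp_le_card_mul_exp`), because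
`b' ⬝ v` is a sum over the `k` blocks, small unless the two selections share columns. So row `i`
switched off is not distinguishable from row `i` switched on with a random selection
(`card_mul_le_lintegral_add_sum_withDensity`), and averaging over all `γ` and all balanced
`l` bounds the risk from below by a multiple of `kτ / χ` (`exists_le_sum_lintegral_designLaw`,
`ofReal_le_minimaxRisk`).

*Parameters.* Take `τ` a small multiple of `Γ₂ / √N` and `k` of order `Γ₁ (Γ₂ / √N)^(-q)`. Then `kτ`
is of order `Γ₁ (Γ₂ / √N)^(1 - q)`, the upper bound on `Γ₁` keeps `kτ` small and `k² ≤ N`, and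
`N^β ≤ exp (Γ₂ ^ 2 / 2)` with `β > 1` leaves room for a block size `B` which keeps `χ` bounded
(`exists_design_parameters`).
-/

noncomputable section

/-! ### Regression of one coordinate of a Gaussian vector on the others -/

/-- The covariance matrix obtained from `Q` by adding the vector `v` to row `i` and to column `i`.
When coordinate `i` is uncorrelated with the others under `Q` and `v i = 0`, this prescribes the
covariances `v` between coordinate `i` and the others. -/
def Matrix.link {ι : Type*} [DecidableEq ι] (Q : Matrix ι ι ℝ) (i : ι) (v : ι → ℝ) :
    Matrix ι ι ℝ :=
  Matrix.of fun a b => Q a b + (if a = i then v b else 0) + (if b = i then v a else 0)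

section Link

variable {ι : Type*} [Fintype ι] [DecidableEq ι]

theorem Matrix.dotProduct_link_mulVec (Q : Matrix ι ι ℝ) (i : ι) (v x y : ι → ℝ) :
    x ⬝ᵥ (Q.link i v).mulVec y = x ⬝ᵥ Q.mulVec y + x i * (v ⬝ᵥ y) + y i * (v ⬝ᵥ x) := by
  have h : (Q.link i v).mulVec y
      = Q.mulVec y + (v ⬝ᵥ y) • Pi.single i (1 : ℝ) + y i • v := by
    ext a
    simp only [Matrix.mulVec, dotProduct, Matrix.link, Matrix.of_apply, add_mul,
      Finset.sum_add_distrib, Pi.add_apply, Pi.smul_apply, smul_eq_mul, Pi.single_apply,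
      ite_mul, zero_mul, Finset.sum_ite_eq', Finset.mem_univ, if_true]
    split_ifs <;> simp [mul_comm]
  rw [h, dotProduct_add, dotProduct_add, dotProduct_smul, dotProduct_smul,
    dotProduct_single_one, dotProduct_comm x v]
  simp only [smul_eq_mul]; ring

/-- Replace coordinate `i` of `ω` by `b ⬝ ω + s x`, where `p = (ω, x)`. -/
def resample (i : ι) (b : ι → ℝ) (s : ℝ) (p : EuclideanSpace ℝ ι × ℝ) : EuclideanSpace ℝ ι :=
  WithLp.toLp 2 (Function.update p.1.ofLp i (b ⬝ᵥ p.1.ofLp + s * p.2))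

theorem measurable_resample (i : ι) (b : ι → ℝ) (s : ℝ) : Measurable (resample i b s) := by
  unfold resample dotProduct
  refine (PiLp.continuous_toLp 2 _).measurable.comp ?_
  refine measurable_pi_iff.2 fun j => ?_
  by_cases h : j = i
  · subst h; simp only [Function.update_self]; fun_prop
  · simp only [Function.update_of_ne h]; fun_prop

/-- A centered Gaussian vector whose coordinate `i` has unit variance and covariances `v` with the
other coordinates is obtained by regression: coordinate `i` is a linear form `b` of the others,
where `Q b = v`, plus independent noise of the remaining variance `1 - b ⬝ v`. -/
theorem map_resample_eq_multivariateGaussian {Q : Matrix ι ι ℝ} {i : ι} {v b : ι → ℝ}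
    (hQ : Q.PosSemidef) (hL : (Q.link i v).PosSemidef) (hi : Q i = Pi.single i 1)
    (hv : v i = 0) (hb : b i = 0) (hbv : Q.mulVec b = v) (h1 : b ⬝ᵥ v ≤ 1) :
    ((multivariateGaussian 0 Q).prod (gaussianReal 0 1)).map (resample i b √(1 - b ⬝ᵥ v)) =
      multivariateGaussian 0 (Q.link i v) := by
  set s := √(1 - b ⬝ᵥ v)
  have hs2 : s ^ 2 = 1 - b ⬝ᵥ v := Real.sq_sqrt (by linarith)
  have : IsProbabilityMeasure
      (((multivariateGaussian 0 Q).prod (gaussianReal 0 1)).map (resample i b s)) :=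
    Measure.isProbabilityMeasure_map (measurable_resample i b s).aemeasurable
  -- Compare characteristic functions at `t`. Moving the regression over to the other side replaces
  -- `t` by `t' = t₀ + t i • b`, where `t₀` is `t` without its coordinate `i`.
  apply Measure.ext_of_charFun
  ext t
  set t₀ : ι → ℝ := Function.update t.ofLp i 0 with ht₀
  have ht : t.ofLp = t₀ + t i • Pi.single i 1 := by
    ext j
    by_cases h : j = i
    · subst h; simp [ht₀]
    · simp [ht₀, h]
  set t' : EuclideanSpace ℝ ι := WithLp.toLp 2 (t₀ + t i • b) with ht'
  have ht₀i : t₀ i = 0 := by simp [ht₀]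
  have key (p : EuclideanSpace ℝ ι × ℝ) :
      inner ℝ (resample i b s p) t = inner ℝ p.1 t' + inner ℝ p.2 (s * t i) := by
    have e1 : inner ℝ (resample i b s p) t
        = (Function.update p.1.ofLp i (b ⬝ᵥ p.1.ofLp + s * p.2)) ⬝ᵥ t.ofLp := by
      simp [EuclideanSpace.inner_eq_star_dotProduct, resample, dotProduct_comm]
    have e2 : inner ℝ p.1 t' = p.1.ofLp ⬝ᵥ (t₀ + t i • b) := by
      simp [EuclideanSpace.inner_eq_star_dotProduct, ht', dotProduct_comm]
    have e3 : (Function.update p.1.ofLp i (b ⬝ᵥ p.1.ofLp + s * p.2)) ⬝ᵥ t₀ = p.1.ofLp ⬝ᵥ t₀ := by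
      refine Finset.sum_congr rfl fun j _ => ?_
      by_cases h : j = i
      · subst h; simp [ht₀i]
      · simp [h]
    rw [e1, e2, ht, dotProduct_add, e3, dotProduct_smul, dotProduct_single_one, dotProduct_add,
      dotProduct_smul]
    simp [dotProduct_comm b, ht₀i]
    ring
  rw [charFun_apply, integral_map (measurable_resample i b s).aemeasurable (by fun_prop)]
  simp_rw [key]
  have : ∀ p : EuclideanSpace ℝ ι × ℝ,
      Complex.exp (((inner ℝ p.1 t' + inner ℝ p.2 (s * t i) : ℝ) : ℂ) * Complex.I)
      = Complex.exp ((inner ℝ p.1 t' : ℝ) * Complex.I) *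
        Complex.exp ((inner ℝ p.2 (s * t i) : ℝ) * Complex.I) := by
    intro p; rw [← Complex.exp_add]; push_cast; ring_nf
  simp_rw [this]
  rw [integral_prod_mul (fun x : EuclideanSpace ℝ ι => Complex.exp ((inner ℝ x t' : ℝ) * Complex.I))
    (fun x : ℝ => Complex.exp ((inner ℝ x (s * t i) : ℝ) * Complex.I)),
    ← charFun_apply, ← charFun_apply, charFun_multivariateGaussian hQ,
    charFun_multivariateGaussian hL, charFun_gaussianReal, ← Complex.exp_add]
  congr 1
  have hQt : ∀ x y : ι → ℝ, x ⬝ᵥ Q.mulVec y = y ⬝ᵥ Q.mulVec x := by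
    intro x y
    have hT : Q.transpose = Q := by simpa using! hQ.isHermitian
    rw [Matrix.dotProduct_mulVec, ← Matrix.mulVec_transpose, hT, dotProduct_comm]
  have hQi : ∀ y : ι → ℝ, (Q.mulVec y) i = y i := by
    intro y; simp [Matrix.mulVec, hi]
  -- The two exponents agree because `Q b = v` and the noise has variance `1 - b ⬝ v`.
  have quad : t'.ofLp ⬝ᵥ Q.mulVec t'.ofLp + (s * t i) ^ 2
      = t.ofLp ⬝ᵥ (Q.link i v).mulVec t.ofLp := by
    have e0 : t₀ ⬝ᵥ Q.mulVec (Pi.single i 1) = 0 := by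
      rw [hQt, single_one_dotProduct, hQi, ht₀i]
    have e1 : (Pi.single i (1:ℝ)) ⬝ᵥ Q.mulVec (Pi.single i 1) = 1 := by
      rw [single_one_dotProduct, hQi]; simp
    have e2 : v ⬝ᵥ t.ofLp = v ⬝ᵥ t₀ := by
      rw [ht, dotProduct_add, dotProduct_smul, dotProduct_single_one, hv]; simp
    rw [Matrix.dotProduct_link_mulVec, e2]
    have e3 : t.ofLp ⬝ᵥ Q.mulVec t.ofLp = t₀ ⬝ᵥ Q.mulVec t₀ + t i ^ 2 := by
      conv_lhs => rw [ht]
      simp only [Matrix.mulVec_add, Matrix.mulVec_smul, dotProduct_add, add_dotProduct,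
        dotProduct_smul, smul_dotProduct, smul_eq_mul, e0, e1, hQt (Pi.single i 1) t₀]
      ring
    rw [e3]
    simp only [ht', Matrix.mulVec_add, Matrix.mulVec_smul, dotProduct_add, add_dotProduct,
        dotProduct_smul, smul_dotProduct, smul_eq_mul, hbv, hQt b t₀, mul_pow, hs2,
        dotProduct_comm v t₀]
    ring
  simp only [inner_zero_right, Complex.ofReal_zero, zero_mul, NNReal.coe_one, mul_zero, zero_sub]
  rw [← quad]
  push_cast
  ring

/-- Likelihood ratio, at `ω`, between the laws in which coordinate `i` given the others is
`N(b ⬝ ω, r)` and `N(0, 1)`. -/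
def linkDensity (i : ι) (b : ι → ℝ) (r : ℝ) (ω : EuclideanSpace ℝ ι) : ℝ≥0∞ :=
  gaussianPDF (b ⬝ᵥ ω.ofLp) r.toNNReal (ω i) / gaussianPDF 0 1 (ω i)

theorem measurable_gaussianPDF_comp {α : Type*} [MeasurableSpace α] {f g : α → ℝ} (r : NNReal)
    (hf : Measurable f) (hg : Measurable g) : Measurable fun a => gaussianPDF (f a) r (g a) :=
  measurable_uncurry_gaussianPDF.comp (hf.prodMk (measurable_const.prodMk hg))

omit [DecidableEq ι] in
theorem measurable_linkDensity (i : ι) (b : ι → ℝ) (r : ℝ) : Measurable (linkDensity i b r) := by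
  unfold linkDensity
  refine Measurable.div (measurable_gaussianPDF_comp _ ?_ (by fun_prop))
    ((measurable_gaussianPDF 0 1).comp (by fun_prop))
  unfold dotProduct; fun_prop

omit [DecidableEq ι] in
theorem linkDensity_ne_top (i : ι) (b : ι → ℝ) (r : ℝ) (ω : EuclideanSpace ℝ ι) :
    linkDensity i b r ω ≠ ∞ :=
  ENNReal.div_ne_top gaussianPDF_ne_top (gaussianPDF_pos 0 one_ne_zero _).ne'

theorem dotProduct_update_of_eq_zero {b : ι → ℝ} {i : ι} (hb : b i = 0) (y : ι → ℝ) (c : ℝ) :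
    b ⬝ᵥ Function.update y i c = b ⬝ᵥ y := by
  refine Finset.sum_congr rfl fun j _ => ?_
  by_cases h : j = i
  · subst h; simp [hb]
  · simp [h]

omit [Fintype ι] in
theorem Matrix.link_zero (Q : Matrix ι ι ℝ) (i : ι) : Q.link i 0 = Q := by
  ext; simp [Matrix.link]

/-- Change of measure from `N(a, s²)` to the standard Gaussian law. -/
theorem lintegral_gaussianReal_affine {a s : ℝ} (hs : 0 < s) {f : ℝ → ℝ≥0∞} (hf : Measurable f) :
    ∫⁻ x, f (a + s * x) ∂(gaussianReal 0 1) =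
      ∫⁻ x, f x * (gaussianPDF a (s ^ 2).toNNReal x / gaussianPDF 0 1 x) ∂(gaussianReal 0 1) := by
  have hs2 : (s ^ 2).toNNReal ≠ 0 := by
    simp only [ne_eq, Real.toNNReal_eq_zero, not_le]; positivity
  have h1 : (gaussianReal 0 1).map (fun x => a + s * x) = gaussianReal a (s ^ 2).toNNReal := by
    have : (fun x => a + s * x) = (fun x => a + x) ∘ (fun x => s * x) := rfl
    rw [this, ← Measure.map_map (by fun_prop) (by fun_prop), gaussianReal_map_const_mul,
      gaussianReal_map_const_add]
    congr 1
    · simp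
    · ext; simp; positivity
  rw [← lintegral_map hf (by fun_prop), h1, gaussianReal_of_var_ne_zero _ hs2,
    gaussianReal_of_var_ne_zero _ one_ne_zero,
    lintegral_withDensity_eq_lintegral_mul _ (measurable_gaussianPDF _ _) hf,
    lintegral_withDensity_eq_lintegral_mul _ (measurable_gaussianPDF _ _) (show Measurable
      fun x => f x * (gaussianPDF a (s ^ 2).toNNReal x / gaussianPDF 0 1 x) from
      hf.mul ((measurable_gaussianPDF _ _).div (measurable_gaussianPDF _ _)))]
  refine lintegral_congr fun x => ?_
  simp only [Pi.mul_apply]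
  rw [mul_left_comm, ENNReal.mul_div_cancel (gaussianPDF_pos 0 one_ne_zero _).ne'
    gaussianPDF_ne_top, mul_comm]

/-- Linking coordinate `i` to the others amounts to a change of density. Since `linkDensity` is a
ratio of one-dimensional densities, this needs no density of the vector, and `Q` may be singular. -/
theorem multivariateGaussian_link_eq_withDensity {Q : Matrix ι ι ℝ} {i : ι} {v b : ι → ℝ}
    (hQ : Q.PosSemidef) (hL : (Q.link i v).PosSemidef) (hi : Q i = Pi.single i 1)
    (hv : v i = 0) (hb : b i = 0) (hbv : Q.mulVec b = v) (h1 : b ⬝ᵥ v < 1) :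
    multivariateGaussian 0 (Q.link i v) =
      (multivariateGaussian 0 Q).withDensity (linkDensity i b (1 - b ⬝ᵥ v)) := by
  have hpos : 0 < 1 - b ⬝ᵥ v := by linarith
  -- `Q` itself is the case `v = 0`: its coordinate `i` may be resampled freely.
  have h0 : ((multivariateGaussian 0 Q).prod (gaussianReal 0 1)).map (resample i 0 1) =
      multivariateGaussian 0 Q := by
    have := map_resample_eq_multivariateGaussian (Q := Q) (i := i) (v := 0) (b := 0) hQ
      (by rwa [Matrix.link_zero]) hi rfl rfl (by simp) (by simp)
    simpa [Matrix.link_zero] using this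
  refine Measure.ext_of_lintegral _ fun f hf => ?_
  have hD := measurable_linkDensity i b (1 - b ⬝ᵥ v)
  rw [lintegral_withDensity_eq_lintegral_mul _ hD hf]
  conv_rhs => rw [← h0]
  rw [← map_resample_eq_multivariateGaussian hQ hL hi hv hb hbv h1.le,
    lintegral_map hf (measurable_resample _ _ _),
    lintegral_map (hD.mul hf) (measurable_resample _ _ _),
    lintegral_prod (fun p => f _) (hf.comp (measurable_resample _ _ _)).aemeasurable,
    lintegral_prod (fun p => (_ * f) _) ((hD.mul hf).comp (measurable_resample _ _ _)).aemeasurable]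
  refine lintegral_congr fun ω => ?_
  have hfu : Measurable fun x : ℝ => f (WithLp.toLp 2 (Function.update ω.ofLp i x)) :=
    hf.comp ((PiLp.continuous_toLp 2 _).measurable.comp (measurable_update _))
  have := lintegral_gaussianReal_affine (a := b ⬝ᵥ ω.ofLp) (Real.sqrt_pos.2 hpos) hfu
  rw [Real.sq_sqrt hpos.le] at this
  simp only [resample, this, linkDensity, Pi.mul_apply]
  refine lintegral_congr fun x => ?_
  simp [dotProduct_update_of_eq_zero hb, mul_comm]

/-- The integral of a Gaussian density along a line in the mean and the argument together: only the
difference `(1 - ρ) * x - g` counts. -/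
theorem lintegral_gaussianPDF_affine {ρ : ℝ} (hρ : ρ < 1) (g : ℝ) {r : NNReal} (hr : r ≠ 0) :
    ∫⁻ x, gaussianPDF (ρ * x + g) r x = ENNReal.ofReal (1 - ρ)⁻¹ := by
  have hc : 0 < 1 - ρ := by linarith
  have h : ∀ x, gaussianPDF (ρ * x + g) r x = gaussianPDF g r ((1 - ρ) * x) := by
    intro x
    simp only [gaussianPDF, gaussianPDFReal]
    congr 4
    ring
  simp_rw [h]
  rw [← lintegral_map (measurable_gaussianPDF g r) (measurable_const_mul (1 - ρ)),
    Real.map_volume_mul_left hc.ne', lintegral_smul_measure, lintegral_gaussianPDF_eq_one _ hr,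
    abs_of_pos (inv_pos.2 hc), smul_eq_mul, mul_one]

theorem covariance_dotProduct_multivariateGaussian {Q : Matrix ι ι ℝ} (hQ : Q.PosSemidef)
    (a b : ι → ℝ) :
    cov[fun ω => a ⬝ᵥ ω.ofLp, fun ω => b ⬝ᵥ ω.ofLp; multivariateGaussian 0 Q] =
      a ⬝ᵥ Q.mulVec b := by
  have h (a : ι → ℝ) : (fun ω : EuclideanSpace ℝ ι => a ⬝ᵥ ω.ofLp) =
      fun ω => inner ℝ (WithLp.toLp 2 a) ω := by
    ext; simp [EuclideanSpace.inner_eq_star_dotProduct, dotProduct_comm]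
  rw [h, h, ← covarianceBilin_apply_eq_cov, covarianceBilin_multivariateGaussian hQ]
  exact IsGaussian.memLp_two_id

/-- The residual of a linear form after regression on a coordinate of unit variance is independent
of that coordinate. -/
theorem indepFun_residual {Q : Matrix ι ι ℝ} (hQ : Q.PosSemidef) {i : ι} (hi : Q i i = 1)
    (b : ι → ℝ) :
    IndepFun (fun ω : EuclideanSpace ℝ ι => ω i)
      (fun ω => (b - (Q.mulVec b) i • Pi.single i 1) ⬝ᵥ ω.ofLp) (multivariateGaussian 0 Q) := by
  set a : ι → ℝ := b - (Q.mulVec b) i • Pi.single i 1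
  apply HasGaussianLaw.indepFun_of_covariance_eq_zero
  · let L : EuclideanSpace ℝ ι →L[ℝ] ℝ × ℝ :=
      (EuclideanSpace.proj i).prod (innerSL ℝ (WithLp.toLp 2 a))
    have := (IsGaussian.hasGaussianLaw_id (μ := multivariateGaussian 0 Q)).map_fun L
    refine this.congr (ae_of_all _ fun ω => ?_)
    simp [L, EuclideanSpace.inner_eq_star_dotProduct, dotProduct_comm]
  · have := covariance_dotProduct_multivariateGaussian hQ (Pi.single i 1) a
    simp only [single_one_dotProduct] at this
    rw [this]
    simp [a, Matrix.mulVec_sub, Matrix.mulVec_smul, hi]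

/-- The mean of a likelihood ratio under a Gaussian law in which coordinate `i` may be correlated
with the form `b`, with covariance `(Q b) i`; it is `1` when they are uncorrelated. -/
theorem lintegral_linkDensity {Q : Matrix ι ι ℝ} (hQ : Q.PosSemidef) {i : ι} (hi : Q i i = 1)
    (b : ι → ℝ) (hρ : (Q.mulVec b) i < 1) {r : ℝ} (hr : 0 < r) :
    ∫⁻ ω, linkDensity i b r ω ∂(multivariateGaussian 0 Q) =
      ENNReal.ofReal (1 - (Q.mulVec b) i)⁻¹ := by
  set ρ := (Q.mulVec b) i
  set g : EuclideanSpace ℝ ι → ℝ := fun ω => (b - ρ • Pi.single i 1) ⬝ᵥ ω.ofLp with hg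
  have hgm : Measurable g := by simp only [hg, dotProduct]; fun_prop
  have hind : IndepFun (fun ω : EuclideanSpace ℝ ι => ω i) g (multivariateGaussian 0 Q) :=
    indepFun_residual hQ hi b
  have hb (ω : EuclideanSpace ℝ ι) : b ⬝ᵥ ω.ofLp = ρ * ω i + g ω := by
    simp [hg, sub_dotProduct]
  let F : ℝ × ℝ → ℝ≥0∞ := fun p => gaussianPDF (ρ * p.1 + p.2) r.toNNReal p.1 / gaussianPDF 0 1 p.1
  have hF : Measurable F := (measurable_gaussianPDF_comp _ (by fun_prop) (by fun_prop)).div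
    ((measurable_gaussianPDF 0 1).comp measurable_fst)
  have hlaw : (multivariateGaussian 0 Q).map (fun ω : EuclideanSpace ℝ ι => ω i)
      = gaussianReal 0 1 := by
    have := (measurePreserving_eval_multivariateGaussian (μ := 0) hQ (i := i)).map_eq
    simpa [hi] using this
  have e : ∀ ω, linkDensity i b r ω = F (ω i, g ω) := fun ω => by
    simp only [linkDensity, F, hb]
  simp_rw [e]
  have hmi : Measurable fun ω : EuclideanSpace ℝ ι => ω i := by fun_prop
  have : IsProbabilityMeasure ((multivariateGaussian 0 Q).map g) :=
    Measure.isProbabilityMeasure_map hgm.aemeasurable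
  rw [← lintegral_map hF (hmi.prodMk hgm),
    (indepFun_iff_map_prod_eq_prod_map_map hmi.aemeasurable hgm.aemeasurable).1 hind, hlaw,
    lintegral_prod_symm _ hF.aemeasurable]
  -- Given the residual `y`, the density of coordinate `i` cancels the denominator.
  have inner (y : ℝ) : ∫⁻ x, F (x, y) ∂(gaussianReal 0 1) = ENNReal.ofReal (1 - ρ)⁻¹ := by
    rw [gaussianReal_of_var_ne_zero _ one_ne_zero,
      lintegral_withDensity_eq_lintegral_mul _ (measurable_gaussianPDF _ _)
        (show Measurable fun x => F (x, y) from hF.comp (by fun_prop)),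
      ← lintegral_gaussianPDF_affine hρ y (r := r.toNNReal) (by simpa using hr)]
    refine lintegral_congr fun x => ?_
    simp only [Pi.mul_apply, F]
    rw [ENNReal.mul_div_cancel (gaussianPDF_pos 0 one_ne_zero _).ne' gaussianPDF_ne_top]
  simp_rw [inner]
  simp

/-- The second-moment computation behind the chi-square bound: two links of the same coordinate,
with regression forms `b`, `b'`, have likelihood ratios whose product has mean `1 / (1 - b' ⬝ v)`,
where `v = Q b`. -/
theorem lintegral_linkDensity_mul {Q : Matrix ι ι ℝ} {i : ι} {v b b' : ι → ℝ}
    (hQ : Q.PosSemidef) (hL : (Q.link i v).PosSemidef) (hi : Q i = Pi.single i 1)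
    (hv : v i = 0) (hb : b i = 0) (hb' : b' i = 0) (hbv : Q.mulVec b = v) (h1 : b ⬝ᵥ v < 1)
    (hρ : b' ⬝ᵥ v < 1) {r : ℝ} (hr : 0 < r) :
    ∫⁻ ω, linkDensity i b (1 - b ⬝ᵥ v) ω * linkDensity i b' r ω ∂(multivariateGaussian 0 Q) =
      ENNReal.ofReal (1 - b' ⬝ᵥ v)⁻¹ := by
  have hm : ((Q.link i v).mulVec b') i = b' ⬝ᵥ v := by
    have := Matrix.dotProduct_link_mulVec Q i v (Pi.single i 1) b'
    simp only [single_one_dotProduct] at this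
    rw [this]
    simp [Matrix.mulVec, hi, hv, hb', dotProduct_comm]
  -- The first ratio is the density of the linked law, under which `v` is the covariance with
  -- coordinate `i`.
  have := lintegral_linkDensity hL (i := i) (by simp [Matrix.link, hi, hv]) b' (by rwa [hm]) hr
  rw [hm, multivariateGaussian_link_eq_withDensity hQ hL hi hv hb hbv h1,
    lintegral_withDensity_eq_lintegral_mul _ (measurable_linkDensity _ _ _)
      (measurable_linkDensity _ _ _)] at this
  exact this

end Link

/-! ### Testing a law against a mixture -/

section Mixture

variable {α : Type*} [MeasurableSpace α]

theorem lintegral_pi_prod {N : ℕ} (μ : Measure α) [IsProbabilityMeasure μ]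
    {f : Fin N → α → ℝ≥0∞} (hf : ∀ n, Measurable (f n)) :
    ∫⁻ ω, ∏ n, f n (ω n) ∂(Measure.pi fun _ : Fin N => μ) = ∏ n, ∫⁻ a, f n a ∂μ := by
  have hind : iIndepFun (fun n (ω : Fin N → α) => f n (ω n)) (Measure.pi fun _ : Fin N => μ) :=
    iIndepFun_pi fun n => (hf n).aemeasurable
  rw [lintegral_prod_eq_prod_lintegral_of_indepFun _ _ hind
    fun n => (hf n).comp (measurable_pi_apply n)]
  refine Finset.prod_congr rfl fun n _ => ?_
  exact (measurePreserving_eval (fun _ : Fin N => μ) n).lintegral_comp (hf n)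

/-- The `N`-fold product of a law with density is the law with the product density. -/
theorem pi_withDensity {N : ℕ} (μ : Measure α) [IsProbabilityMeasure μ] {f : α → ℝ≥0∞}
    (hf : Measurable f) [SigmaFinite (μ.withDensity f)] :
    (Measure.pi fun _ : Fin N => μ.withDensity f) =
      (Measure.pi fun _ : Fin N => μ).withDensity fun ω => ∏ n, f (ω n) := by
  refine Measure.pi_eq fun s hs => ?_
  have hS : MeasurableSet (Set.univ.pi s) := MeasurableSet.univ_pi hs
  rw [withDensity_apply _ hS, ← lintegral_indicator hS]
  have : (Set.univ.pi s).indicator (fun ω : Fin N → α => ∏ n, f (ω n)) =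
      fun ω => ∏ n, (s n).indicator f (ω n) := by
    ext ω
    by_cases h : ω ∈ Set.univ.pi s
    · rw [Set.indicator_of_mem h]
      exact Finset.prod_congr rfl fun n _ => (Set.indicator_of_mem (h n trivial) _).symm
    · rw [Set.indicator_of_notMem h]
      simp only [Set.mem_pi, Set.mem_univ, true_imp_iff, not_forall] at h
      obtain ⟨n, hn⟩ := h
      exact (Finset.prod_eq_zero (Finset.mem_univ n) (Set.indicator_of_notMem hn _)).symm
  rw [this, lintegral_pi_prod μ fun n => hf.indicator (hs n)]
  refine Finset.prod_congr rfl fun n _ => ?_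
  rw [lintegral_indicator (hs n), withDensity_apply _ (hs n)]

/-- Truncation at level `n` costs at most a multiple of the square. -/
theorem ENNReal.mul_le_min_add_sq {n χ : ℝ} (hn : 0 < n) (hχ : 1 ≤ χ) {x : ℝ≥0∞} (hx : x ≠ ∞) :
    ENNReal.ofReal χ⁻¹ * x ≤
      min (ENNReal.ofReal n) x + ENNReal.ofReal (1 / (4 * χ ^ 2 * n)) * (x * x) := by
  have hχ0 : 0 < χ := by linarith
  obtain ⟨t, ht, rfl⟩ : ∃ t : ℝ, 0 ≤ t ∧ x = ENNReal.ofReal t :=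
    ⟨x.toReal, ENNReal.toReal_nonneg, (ENNReal.ofReal_toReal hx).symm⟩
  rw [← ENNReal.ofReal_min, ← ENNReal.ofReal_mul ht, ← ENNReal.ofReal_mul (by positivity),
    ← ENNReal.ofReal_mul (by positivity), ← ENNReal.ofReal_add (by positivity) (by positivity)]
  apply ENNReal.ofReal_le_ofReal
  rcases le_total n t with h | h
  · rw [min_eq_left h]
    -- the arithmetic-geometric mean inequality
    have : n + 1 / (4 * χ ^ 2 * n) * (t * t) - χ⁻¹ * t = (t / (2 * χ) - n) ^ 2 / n := by
      field_simp; ring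
    have : 0 ≤ (t / (2 * χ) - n) ^ 2 / n := by positivity
    linarith
  · rw [min_eq_right h]
    have h1 : χ⁻¹ * t ≤ 1 * t := by gcongr; exact inv_le_one_of_one_le₀ hχ
    have : 0 ≤ 1 / (4 * χ ^ 2 * n) * (t * t) := by positivity
    linarith

/-- A two-point bound for testing `μ` against the uniform mixture of the laws
`μ.withDensity (L S)`, `S ∈ F`: if the second moment of the mixture likelihood ratio is at most `χ`,
no `w` is close to `0` under `μ` and to `a` under the mixture. -/
theorem card_mul_le_lintegral_add_sum_withDensity {κ : Type*} {μ : Measure α}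
    (F : Finset κ) (hF : F.Nonempty) {L : κ → α → ℝ≥0∞} (hL : ∀ S ∈ F, Measurable (L S))
    (hLt : ∀ S ∈ F, ∀ x, L S x ≠ ∞) (hL1 : ∀ S ∈ F, ∫⁻ x, L S x ∂μ = 1) {χ : ℝ} (hχ : 1 ≤ χ)
    (hχ2 : ∑ S ∈ F, ∑ T ∈ F, ∫⁻ x, L S x * L T x ∂μ ≤ ENNReal.ofReal ((F.card : ℝ) ^ 2 * χ))
    {w : α → ℝ} (hw : AEMeasurable w μ) {a : ℝ} (ha : 0 ≤ a) :
    F.card * ENNReal.ofReal (3 * a / (4 * χ)) ≤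
      F.card * ∫⁻ x, ‖w x‖ₑ ∂μ + ∑ S ∈ F, ∫⁻ x, ‖w x - a‖ₑ ∂(μ.withDensity (L S)) := by
  have hn : (0 : ℝ) < F.card := by exact_mod_cast hF.card_pos
  have hχ0 : 0 < χ := by linarith
  set G : α → ℝ≥0∞ := fun x => ∑ S ∈ F, L S x with hG
  have hGm : Measurable G := Finset.measurable_fun_sum _ hL
  have hGt (x : α) : G x ≠ ∞ := ENNReal.sum_ne_top.2 fun S hS => hLt S hS x
  have hG1 : ∫⁻ x, G x ∂μ = ENNReal.ofReal F.card := by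
    rw [hG, lintegral_finsetSum _ hL, Finset.sum_congr rfl hL1]; simp
  have hG2 : ∫⁻ x, G x * G x ∂μ ≤ ENNReal.ofReal ((F.card : ℝ) ^ 2 * χ) := by
    refine le_trans (le_of_eq ?_) hχ2
    simp only [hG, Finset.sum_mul_sum]
    rw [lintegral_finsetSum _ fun S hS => Finset.measurable_fun_sum _ fun T hT =>
      (hL S hS).fun_mul (hL T hT)]
    exact Finset.sum_congr rfl fun S hS => lintegral_finsetSum _ fun T hT =>
      (hL S hS).fun_mul (hL T hT)
  -- The mixture likelihood ratio `G / |F|`, truncated at `1`, keeps the mass `3 / (4χ)`.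
  have hmin : ENNReal.ofReal (3 * F.card / (4 * χ)) ≤
      ∫⁻ x, min (ENNReal.ofReal F.card) (G x) ∂μ := by
    have h := lintegral_mono (μ := μ) fun x => ENNReal.mul_le_min_add_sq hn hχ (hGt x)
    rw [lintegral_const_mul _ hGm, lintegral_add_left (measurable_const.min hGm),
      lintegral_const_mul _ (hGm.fun_mul hGm), hG1, ← ENNReal.ofReal_mul (by positivity)] at h
    have h2 : ENNReal.ofReal (1 / (4 * χ ^ 2 * F.card)) * ∫⁻ x, G x * G x ∂μ ≤
        ENNReal.ofReal (F.card / (4 * χ)) := by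
      refine (mul_le_mul_right hG2 _).trans (le_of_eq ?_)
      rw [← ENNReal.ofReal_mul (by positivity)]
      congr 1
      field_simp
    have h3 := h.trans (add_le_add_right h2 _)
    have e : χ⁻¹ * (F.card : ℝ) = 3 * F.card / (4 * χ) + F.card / (4 * χ) := by
      field_simp; ring
    rw [e, ENNReal.ofReal_add (by positivity) (by positivity)] at h3
    exact ENNReal.le_of_add_le_add_right ENNReal.ofReal_ne_top h3
  have hwm : AEMeasurable (fun x => ‖w x - a‖ₑ) μ := (hw.sub_const a).enorm
  have hsum : F.card * ∫⁻ x, ‖w x‖ₑ ∂μ + ∑ S ∈ F, ∫⁻ x, ‖w x - a‖ₑ ∂(μ.withDensity (L S)) =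
      ∫⁻ x, F.card * ‖w x‖ₑ + G x * ‖w x - a‖ₑ ∂μ := by
    rw [lintegral_add_left' (hw.enorm.const_mul _), lintegral_const_mul'' _ hw.enorm]
    congr 1
    simp only [hG, Finset.sum_mul]
    rw [lintegral_finsetSum' _ fun S hS => (hL S hS).aemeasurable.fun_mul hwm]
    refine Finset.sum_congr rfl fun S hS => ?_
    rw [lintegral_withDensity_eq_lintegral_mul_non_measurable _ (hL S hS)
      (ae_of_all _ fun x => (hLt S hS x).lt_top)]
    rfl
  rw [hsum]
  calc (F.card : ℝ≥0∞) * ENNReal.ofReal (3 * a / (4 * χ))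
      = ENNReal.ofReal (3 * F.card / (4 * χ)) * ENNReal.ofReal a := by
        rw [← ENNReal.ofReal_natCast, ← ENNReal.ofReal_mul (by positivity),
          ← ENNReal.ofReal_mul (by positivity)]
        congr 1; ring
    _ ≤ (∫⁻ x, min (ENNReal.ofReal F.card) (G x) ∂μ) * ENNReal.ofReal a := by gcongr
    _ = ∫⁻ x, min (ENNReal.ofReal F.card) (G x) * ENNReal.ofReal a ∂μ :=
        (lintegral_mul_const _ (measurable_const.min hGm)).symm
    _ ≤ _ := by
        refine lintegral_mono fun x => ?_
        have h1 : ENNReal.ofReal a ≤ ‖w x‖ₑ + ‖w x - a‖ₑ := by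
          rw [← Real.enorm_of_nonneg ha]
          calc ‖a‖ₑ = ‖w x - (w x - a)‖ₑ := by ring_nf
            _ ≤ _ := enorm_sub_le
        refine (mul_le_mul_right h1 _).trans ?_
        rw [mul_add]
        gcongr
        · exact (min_le_left _ _).trans (by simp)
        · exact min_le_right _ _

end Mixture

/-! ### Testing whether a coordinate is linked to the others -/

theorem Real.inv_one_sub_le_exp {x y : ℝ} (hxy : x ≤ y) (hy0 : 0 ≤ y) (hy : y ≤ 1 / 2) :
    (1 - x)⁻¹ ≤ Real.exp (2 * y) := by
  have h1 : 0 < 1 - y := by linarith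
  calc (1 - x)⁻¹ ≤ (1 - y)⁻¹ := by gcongr
    _ ≤ 1 + 2 * y := by
        rw [inv_le_iff_one_le_mul₀ h1]; nlinarith
    _ ≤ Real.exp (2 * y) := by linarith [Real.add_one_le_exp (2 * y)]

section Link

variable {ι : Type*} [Fintype ι] [DecidableEq ι]

/-- The two-point bound for `N` independent copies of a centered Gaussian vector: coordinate `i` is
either independent of the others, or linked to them through the vector `v S`, with `S` drawn
uniformly from `F`. -/
theorem card_mul_le_lintegral_add_sum_link {κ : Type*} {N : ℕ} (F : Finset κ) (hF : F.Nonempty)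
    {Q : Matrix ι ι ℝ} {i : ι} {v b : κ → ι → ℝ} (hQ : Q.PosSemidef)
    (hL : ∀ S ∈ F, (Q.link i (v S)).PosSemidef) (hi : Q i = Pi.single i 1)
    (hv : ∀ S ∈ F, v S i = 0) (hb : ∀ S ∈ F, b S i = 0) (hbv : ∀ S ∈ F, Q.mulVec (b S) = v S)
    {ρ : κ → κ → ℝ} (hρ : ∀ S ∈ F, ∀ T ∈ F, b T ⬝ᵥ v S ≤ ρ S T)
    (hρ0 : ∀ S ∈ F, ∀ T ∈ F, 0 ≤ ρ S T) (hρ2 : ∀ S ∈ F, ∀ T ∈ F, ρ S T ≤ 1 / 2)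
    {χ : ℝ} (hχ : 1 ≤ χ)
    (hχ2 : ∀ T ∈ F, ∑ S ∈ F, Real.exp (2 * N * ρ S T) ≤ F.card * χ)
    {w : (Fin N → EuclideanSpace ℝ ι) → ℝ}
    (hw : AEMeasurable w (Measure.pi fun _ => multivariateGaussian 0 Q)) {a : ℝ} (ha : 0 ≤ a) :
    F.card * ENNReal.ofReal (3 * a / (4 * χ)) ≤
      F.card * ∫⁻ ω, ‖w ω‖ₑ ∂(Measure.pi fun _ => multivariateGaussian 0 Q) +
      ∑ S ∈ F, ∫⁻ ω, ‖w ω - a‖ₑ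
        ∂(Measure.pi fun _ => multivariateGaussian 0 (Q.link i (v S))) := by
  have hlt : ∀ S ∈ F, ∀ T ∈ F, b T ⬝ᵥ v S < 1 := fun S hS T hT => by
    linarith [hρ S hS T hT, hρ2 S hS T hT]
  set ℓ : κ → EuclideanSpace ℝ ι → ℝ≥0∞ := fun S => linkDensity i (b S) (1 - b S ⬝ᵥ v S)
  have hℓ (S : κ) : Measurable (ℓ S) := measurable_linkDensity _ _ _
  have hd : ∀ S ∈ F, multivariateGaussian 0 (Q.link i (v S)) =
      (multivariateGaussian 0 Q).withDensity (ℓ S) := fun S hS =>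
    multivariateGaussian_link_eq_withDensity hQ (hL S hS) hi (hv S hS) (hb S hS) (hbv S hS)
      (hlt S hS S hS)
  have hpi : ∀ S ∈ F, (Measure.pi fun _ : Fin N => multivariateGaussian 0 (Q.link i (v S))) =
      (Measure.pi fun _ : Fin N => multivariateGaussian 0 Q).withDensity
        fun ω => ∏ n, ℓ S (ω n) := fun S hS => by
    have : SigmaFinite ((multivariateGaussian 0 Q).withDensity (ℓ S)) := by
      rw [← hd S hS]; infer_instance
    simp_rw [hd S hS]
    exact pi_withDensity _ (hℓ S)
  rw [Finset.sum_congr rfl fun S hS => by rw [hpi S hS]]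
  refine card_mul_le_lintegral_add_sum_withDensity F hF (fun S _ => ?_) (fun S _ ω => ?_)
    (fun S hS => ?_) hχ ?_ hw ha
  · exact Finset.measurable_fun_prod _ fun n _ => (hℓ S).comp (measurable_pi_apply n)
  · exact ENNReal.prod_ne_top fun n _ => linkDensity_ne_top _ _ _ _
  · have := congrArg (fun μ => μ Set.univ) (hpi S hS)
    simpa using this.symm
  · have hST : ∀ S ∈ F, ∀ T ∈ F, ∫⁻ ω, (∏ n, ℓ S (ω n)) * ∏ n, ℓ T (ω n)
        ∂(Measure.pi fun _ : Fin N => multivariateGaussian 0 Q) ≤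
        ENNReal.ofReal (Real.exp (2 * N * ρ S T)) := by
      intro S hS T hT
      simp_rw [← Finset.prod_mul_distrib]
      rw [lintegral_pi_prod _ (f := fun _ x => ℓ S x * ℓ T x) fun n => (hℓ S).mul (hℓ T),
        lintegral_linkDensity_mul hQ (hL S hS) hi (hv S hS) (hb S hS) (hb T hT) (hbv S hS)
          (hlt S hS S hS) (hlt S hS T hT) (by linarith [hlt T hT T hT]),
        Finset.prod_const, Finset.card_univ, Fintype.card_fin]
      have h1 := Real.inv_one_sub_le_exp (hρ S hS T hT) (hρ0 S hS T hT) (hρ2 S hS T hT)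
      calc _ ≤ ENNReal.ofReal (Real.exp (2 * ρ S T)) ^ N := by gcongr
        _ = _ := by
          rw [← ENNReal.ofReal_pow (Real.exp_nonneg _), ← Real.exp_nat_mul]
          congr 2; ring
    calc _ ≤ ∑ S ∈ F, ∑ T ∈ F, ENNReal.ofReal (Real.exp (2 * N * ρ S T)) :=
          Finset.sum_le_sum fun S hS => Finset.sum_le_sum fun T hT => hST S hS T hT
      _ = ENNReal.ofReal (∑ S ∈ F, ∑ T ∈ F, Real.exp (2 * N * ρ S T)) := by
          rw [ENNReal.ofReal_sum_of_nonneg fun S _ =>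
            Finset.sum_nonneg fun T _ => Real.exp_nonneg _]
          exact Finset.sum_congr rfl fun S _ =>
            (ENNReal.ofReal_sum_of_nonneg fun T _ => Real.exp_nonneg _).symm
      _ ≤ _ := by
          apply ENNReal.ofReal_le_ofReal
          rw [Finset.sum_comm]
          calc _ ≤ ∑ T ∈ F, (F.card : ℝ) * χ := Finset.sum_le_sum hχ2
            _ = _ := by simp; ring

end Link

/-! ### Symmetric perturbations of the identity -/

section Dominant

variable {ι : Type*} [Fintype ι] [DecidableEq ι]

/-- Diagonal dominance implies positive semidefiniteness. -/
theorem Matrix.posSemidef_one_add {E : Matrix ι ι ℝ} (hE : E.transpose = E)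
    (h : ∀ a, ∑ b, |E a b| ≤ 1) : (1 + E).PosSemidef := by
  refine Matrix.PosSemidef.of_dotProduct_mulVec_nonneg ?_ fun x => ?_
  · simp [Matrix.IsHermitian, Matrix.conjTranspose_eq_transpose_of_trivial, hE]
  have e1 : star x ⬝ᵥ (1 + E).mulVec x = ∑ a, x a ^ 2 + ∑ a, ∑ b, E a b * (x a * x b) := by
    simp only [Matrix.add_mulVec, Matrix.one_mulVec, dotProduct_add, star_trivial]
    congr 1
    · simp [dotProduct, sq]
    · simp only [dotProduct, Matrix.mulVec, Finset.mul_sum]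
      exact Finset.sum_congr rfl fun a _ => Finset.sum_congr rfl fun b _ => by ring
  have hsym : ∀ a b, |E b a| = |E a b| := fun a b => by
    conv_rhs => rw [← hE]
    rfl
  have e2 : ∑ a, ∑ b, |E a b| * x b ^ 2 = ∑ a, ∑ b, |E a b| * x a ^ 2 := by
    rw [Finset.sum_comm]
    exact Finset.sum_congr rfl fun a _ => Finset.sum_congr rfl fun b _ => by rw [hsym]
  have e3 : ∑ a, ∑ b, |E a b| * x a ^ 2 ≤ ∑ a, x a ^ 2 := by
    refine Finset.sum_le_sum fun a _ => ?_
    rw [← Finset.sum_mul]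
    exact mul_le_of_le_one_left (sq_nonneg _) (h a)
  have e4 : ∑ a, ∑ b, (-(|E a b| * x a ^ 2 + |E a b| * x b ^ 2) / 2) ≤
      ∑ a, ∑ b, E a b * (x a * x b) := by
    refine Finset.sum_le_sum fun a _ => Finset.sum_le_sum fun b _ => ?_
    have h1 : |E a b * (x a * x b)| = |E a b| * (|x a| * |x b|) := by rw [abs_mul, abs_mul]
    have h2 : |x a| * |x b| ≤ (x a ^ 2 + x b ^ 2) / 2 := by
      nlinarith [sq_nonneg (|x a| - |x b|), sq_abs (x a), sq_abs (x b)]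
    have h3 := mul_le_mul_of_nonneg_left h2 (abs_nonneg (E a b))
    linarith [neg_abs_le (E a b * (x a * x b))]
  have e5 : ∑ a, ∑ b, (-(|E a b| * x a ^ 2 + |E a b| * x b ^ 2) / 2) =
      -(∑ a, ∑ b, |E a b| * x a ^ 2 + ∑ a, ∑ b, |E a b| * x b ^ 2) / 2 := by
    simp only [← Finset.sum_add_distrib, ← Finset.sum_neg_distrib, Finset.sum_div]
  rw [e1]
  linarith

/-- Strict diagonal dominance implies invertibility. -/
theorem Matrix.exists_one_add_mulVec_eq {E : Matrix ι ι ℝ} (h : ∀ a, ∑ b, |E a b| ≤ 1 / 2)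
    (v : ι → ℝ) : ∃ b, (1 + E).mulVec b = v := by
  have hdet : (1 + E).det ≠ 0 := by
    refine det_ne_zero_of_sum_row_lt_diag fun a => ?_
    have h1 : |E a a| + ∑ b ∈ Finset.univ.erase a, |E a b| = ∑ b, |E a b| :=
      Finset.add_sum_erase Finset.univ (fun b => |E a b|) (Finset.mem_univ a)
    have h2 : ∑ b ∈ Finset.univ.erase a, ‖(1 + E) a b‖ = ∑ b ∈ Finset.univ.erase a, |E a b| :=
      Finset.sum_congr rfl fun b hb => by
        simp [Matrix.one_apply_ne (Finset.ne_of_mem_erase hb).symm]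
    have h3 : 1 - |E a a| ≤ ‖(1 + E) a a‖ := by
      simp only [Matrix.add_apply, Matrix.one_apply_eq, Real.norm_eq_abs]
      linarith [le_abs_self (1 + E a a), neg_abs_le (E a a)]
    rw [h2]
    have := h a
    linarith
  refine ⟨(1 + E)⁻¹.mulVec v, ?_⟩
  rw [Matrix.mulVec_mulVec, Matrix.mul_nonsing_inv _ (isUnit_iff_ne_zero.2 hdet), Matrix.one_mulVec]

/-- The inverse of `1 + E` has norm at most `2` on `ℓ^∞`. -/
theorem Matrix.abs_le_of_one_add_mulVec_eq {E : Matrix ι ι ℝ} (h : ∀ a, ∑ b, |E a b| ≤ 1 / 2)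
    {b v : ι → ℝ} (hb : (1 + E).mulVec b = v) {t : ℝ} (hv : ∀ a, |v a| ≤ t) (a : ι) :
    |b a| ≤ 2 * t := by
  obtain ⟨m, -, hm⟩ := Finset.exists_max_image Finset.univ (fun a => |b a|) ⟨a, Finset.mem_univ a⟩
  have h1 : b m = v m - ∑ c, E m c * b c := by
    rw [← hb, Matrix.add_mulVec, Matrix.one_mulVec]; simp [Matrix.mulVec, dotProduct]
  have h2 : |∑ c, E m c * b c| ≤ 1 / 2 * |b m| := by
    calc _ ≤ ∑ c, |E m c * b c| := Finset.abs_sum_le_sum_abs _ _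
      _ ≤ ∑ c, |E m c| * |b m| := Finset.sum_le_sum fun c hc => by
          rw [abs_mul]; exact mul_le_mul_of_nonneg_left (hm c hc) (abs_nonneg _)
      _ ≤ _ := by rw [← Finset.sum_mul]; exact mul_le_mul_of_nonneg_right (h m) (abs_nonneg _)
  have h3 : |b m| ≤ |v m| + |∑ c, E m c * b c| := by rw [h1]; exact abs_sub _ _
  linarith [hm a (Finset.mem_univ a), hv m]

/-- The inverse of `1 + E` has norm at most `2` on `ℓ¹`. -/
theorem Matrix.sum_abs_le_of_one_add_mulVec_eq {E : Matrix ι ι ℝ} (hE : E.transpose = E)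
    (h : ∀ a, ∑ b, |E a b| ≤ 1 / 2) {b v : ι → ℝ} (hb : (1 + E).mulVec b = v) :
    ∑ a, |b a| ≤ 2 * ∑ a, |v a| := by
  have h1 (a : ι) : |b a| ≤ |v a| + ∑ c, |E a c| * |b c| := by
    have : b a = v a - ∑ c, E a c * b c := by
      rw [← hb, Matrix.add_mulVec, Matrix.one_mulVec]; simp [Matrix.mulVec, dotProduct]
    calc |b a| ≤ |v a| + |∑ c, E a c * b c| := by rw [this]; exact abs_sub _ _
      _ ≤ _ := by
        gcongr
        exact (Finset.abs_sum_le_sum_abs _ _).trans_eq (Finset.sum_congr rfl fun c _ => abs_mul _ _)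
  have h2 := Finset.sum_le_sum fun a (_ : a ∈ Finset.univ) => h1 a
  rw [Finset.sum_add_distrib, Finset.sum_comm] at h2
  have h3 : ∑ c, ∑ a, |E a c| * |b c| ≤ ∑ c, 1 / 2 * |b c| := by
    refine Finset.sum_le_sum fun c _ => ?_
    rw [← Finset.sum_mul]
    refine mul_le_mul_of_nonneg_right ?_ (abs_nonneg _)
    refine le_trans (le_of_eq ?_) (h c)
    refine Finset.sum_congr rfl fun a _ => ?_
    conv_lhs => rw [← hE]
    rfl
  rw [← Finset.mul_sum] at h3
  linarith

end Dominant

/-! ### Correlations between rows and columns -/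

section Cross

variable {R C : Type*} [Fintype R] [Fintype C] [DecidableEq R] [DecidableEq C]

/-- The symmetric matrix on `Option (R ⊕ C)`, the index set of a distinguished variable `none`, the
rows `R` and the columns `C`, whose only nonzero entries are those of `Λ` (at
`(row, column)`) and of its transpose (at `(column, row)`). -/
def crossMatrix (Λ : R → C → ℝ) : Matrix (Option (R ⊕ C)) (Option (R ⊕ C)) ℝ :=
  Matrix.of fun a b => match a, b with
    | some (Sum.inl i), some (Sum.inr j) => Λ i j
    | some (Sum.inr j), some (Sum.inl i) => Λ i j
    | _, _ => 0

/-- The correlation matrix with cross-correlations `Λ` between rows and columns: rows are mutually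
uncorrelated, columns are mutually uncorrelated, and the variable `none` is uncorrelated with all
others. -/
def crossCov (Λ : R → C → ℝ) : Matrix (Option (R ⊕ C)) (Option (R ⊕ C)) ℝ := 1 + crossMatrix Λ

/-- The vector on `Option (R ⊕ C)` supported on the columns. -/
def columnVec (ℓ : C → ℝ) : Option (R ⊕ C) → ℝ
  | some (Sum.inr j) => ℓ j
  | _ => 0

omit [Fintype R] [Fintype C] [DecidableEq R] [DecidableEq C] in
theorem crossMatrix_transpose (Λ : R → C → ℝ) : (crossMatrix Λ).transpose = crossMatrix Λ := by
  ext a b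
  rcases a with _ | a | a <;> rcases b with _ | b | b <;> rfl

omit [DecidableEq R] [DecidableEq C] in
theorem sum_crossMatrix {f : ℝ → ℝ} (hf : f 0 = 0) (Λ : R → C → ℝ) (a : Option (R ⊕ C)) :
    ∑ b, f (crossMatrix Λ a b) = match a with
      | none => 0
      | some (Sum.inl i) => ∑ j, f (Λ i j)
      | some (Sum.inr j) => ∑ i, f (Λ i j) := by
  rcases a with _ | a | a <;> simp [Fintype.sum_option, crossMatrix, hf]

omit [DecidableEq R] [DecidableEq C] in
theorem sum_abs_crossMatrix_le {Λ : R → C → ℝ} {s : ℝ} (hs : 0 ≤ s) (hr : ∀ i, ∑ j, |Λ i j| ≤ s)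
    (hc : ∀ j, ∑ i, |Λ i j| ≤ s) (a : Option (R ⊕ C)) : ∑ b, |crossMatrix Λ a b| ≤ s := by
  rw [sum_crossMatrix (f := fun x => |x|) abs_zero]
  rcases a with _ | a | a
  · exact hs
  · exact hr a
  · exact hc a

omit [Fintype R] [Fintype C] in
/-- Giving the correlations `ℓ` to a row without correlations is a link. -/
theorem crossCov_update {Λ : R → C → ℝ} {i : R} (h : Λ i = 0) (ℓ : C → ℝ) :
    crossCov (Function.update Λ i ℓ) = (crossCov Λ).link (some (Sum.inl i)) (columnVec ℓ) := by
  have h' : ∀ j, Λ i j = 0 := fun j => by rw [h]; rfl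
  ext a b
  simp only [crossCov, Matrix.link, Matrix.of_apply, Matrix.add_apply, add_assoc]
  congr 1
  rcases a with _ | a | a <;> rcases b with _ | b | b <;>
    simp only [crossMatrix, columnVec, Matrix.of_apply, Option.some.injEq, Sum.inl.injEq,
      reduceCtorEq, if_false, add_zero, ite_self]
  · by_cases e : a = i
    · subst e; simp [h']
    · simp [e]
  · by_cases e : b = i
    · subst e; simp [h']
    · simp [e]

omit [Fintype R] [Fintype C] in
theorem crossCov_row_of_eq_zero {Λ : R → C → ℝ} {i : R} (h : Λ i = 0) :
    crossCov Λ (some (Sum.inl i)) = Pi.single (some (Sum.inl i)) 1 := by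
  have h' : ∀ j, Λ i j = 0 := fun j => by rw [h]; rfl
  ext b
  rw [crossCov, Matrix.add_apply, Matrix.one_apply, Pi.single_apply]
  rcases b with _ | b | b <;> simp [crossMatrix, h', eq_comm]

end Cross

/-! ### Averaging over switches -/

section Assouad

variable {R V : Type*} [Fintype R] [DecidableEq R] [Fintype V] [DecidableEq V]

/-- Averaging over a finite parameter set `(R → Bool) × D` in the manner of Assouad, when every
coordinate `i` of the parameter can be tested with the others fixed: `γ i` off, against `γ i` on and
`l i` drawn uniformly from the values that keep `l` in `D`. -/
theorem card_mul_le_sum_of_update (D : Finset (R → V)) (i : R) (r : (R → Bool) → (R → V) → ℝ≥0∞)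
    (c : ℝ≥0∞)
    (hr : ∀ γ l S, γ i = false → r γ (Function.update l i S) = r γ l)
    (h : ∀ γ, ∀ l ∈ D,
      ((Finset.univ.filter fun S => Function.update l i S ∈ D).card : ℝ≥0∞) * c ≤
        (Finset.univ.filter fun S => Function.update l i S ∈ D).card *
          r (Function.update γ i false) l +
        ∑ S ∈ Finset.univ.filter fun S => Function.update l i S ∈ D,
          r (Function.update γ i true) (Function.update l i S)) :
    (Fintype.card (R → Bool) * D.card : ℝ≥0∞) * c ≤ 2 * ∑ γ, ∑ l ∈ D, r γ l := by
  have key (γ : R → Bool) : (D.card : ℝ≥0∞) * c ≤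
      ∑ l ∈ D, (r (Function.update γ i false) l + r (Function.update γ i true) l) := by
    rcases D.eq_empty_or_nonempty with rfl | ⟨l₁, _⟩
    · simp
    -- Sum over the fibres of the map that forgets `l i`.
    let π : (R → V) → (R → V) := fun l => Function.update l i (l₁ i)
    have hπ : ∀ l ∈ D, π l ∈ D.image π := fun l hl => Finset.mem_image_of_mem _ hl
    rw [← Finset.sum_fiberwise_of_maps_to hπ, Finset.card_eq_sum_card_fiberwise hπ, Nat.cast_sum,
      Finset.sum_mul]
    refine Finset.sum_le_sum fun x hx => ?_
    obtain ⟨l, hl, rfl⟩ := Finset.mem_image.1 hx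
    have hfib : (D.filter fun l' => π l' = π l) =
        (Finset.univ.filter fun S => Function.update l i S ∈ D).image (Function.update l i) := by
      ext l'
      simp only [Finset.mem_filter, Finset.mem_image, Finset.mem_univ, true_and, π]
      constructor
      · rintro ⟨hl', he⟩
        have : Function.update l i (l' i) = l' := by
          ext j
          by_cases hj : j = i
          · subst hj; simp
          · have := congrFun he j
            simp only [Function.update_of_ne hj] at this ⊢
            exact this.symm
        exact ⟨l' i, by rwa [this], this⟩
      · rintro ⟨S, hS, rfl⟩
        exact ⟨hS, by simp⟩
    rw [hfib, Finset.sum_image (Function.update_injective l i).injOn,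
      Finset.card_image_of_injective _ (Function.update_injective l i), Finset.sum_add_distrib]
    refine (h γ l hl).trans (le_of_eq ?_)
    congr 1
    rw [Finset.sum_congr rfl fun S _ => hr _ l S (by simp)]
    simp
  -- Flipping the switch `i` is a bijection of the parameter set.
  have hflip : ∑ γ : R → Bool, ∑ l ∈ D, r (Function.update γ i (!γ i)) l
      = ∑ γ, ∑ l ∈ D, r γ l := by
    refine Fintype.sum_equiv
      (Function.Involutive.toPerm (fun γ : R → Bool => Function.update γ i (!γ i)) fun γ => ?_) _ _
      fun γ => rfl
    simp
  calc (Fintype.card (R → Bool) * D.card : ℝ≥0∞) * c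
      = ∑ γ : R → Bool, (D.card : ℝ≥0∞) * c := by
        rw [Finset.sum_const, Finset.card_univ, nsmul_eq_mul, mul_assoc]
    _ ≤ ∑ γ : R → Bool, ∑ l ∈ D,
          (r (Function.update γ i false) l + r (Function.update γ i true) l) :=
        Finset.sum_le_sum fun γ _ => key γ
    _ = ∑ γ : R → Bool, ∑ l ∈ D, (r γ l + r (Function.update γ i (!γ i)) l) := by
        refine Finset.sum_congr rfl fun γ _ => Finset.sum_congr rfl fun l _ => ?_
        cases hγ : γ i
        · rw [← hγ, Function.update_eq_self]; simp [hγ]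
        · rw [← hγ, Function.update_eq_self, add_comm]; simp [hγ]
    _ = _ := by
        simp only [Finset.sum_add_distrib]
        rw [hflip, two_mul]

end Assouad

/-! ### Balanced selections -/

section Design

variable {k B : ℕ}

/-- The row vector with entry `τ` at the columns `(a, S a)`, one in each of the `k` blocks, and `0`
elsewhere. -/
def supportRow (τ : ℝ) (S : Fin k → Fin B) (j : Fin k × Fin B) : ℝ := if S j.1 = j.2 then τ else 0

/-- The cross-correlations encoded by `γ` and `l`: the rows with `γ i = true` carry `τ` at the
columns selected by `l i`, the others vanish. -/
def designMatrix {R : Type*} (τ : ℝ) (γ : R → Bool) (l : R → Fin k → Fin B) (i : R) :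
    Fin k × Fin B → ℝ :=
  if γ i then supportRow τ (l i) else 0

/-- The selections in which every column is selected by at most `2k` rows. For `kB` rows this is
twice the average. -/
def balanced (R : Type*) [Fintype R] [DecidableEq R] (k B : ℕ) : Finset (R → Fin k → Fin B) :=
  Finset.univ.filter fun l => ∀ a b, (Finset.univ.filter fun i => l i a = b).card ≤ 2 * k

theorem sum_supportRow {f : ℝ → ℝ} (hf : f 0 = 0) (τ : ℝ) (S : Fin k → Fin B) :
    ∑ j, f (supportRow τ S j) = k * f τ := by
  rw [Fintype.sum_prod_type]
  have (a : Fin k) : ∑ b, f (supportRow τ S (a, b)) = f τ := by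
    rw [Finset.sum_eq_single (S a)] <;> simp +contextual [supportRow, hf, eq_comm]
  simp [this]

theorem sum_mul_supportRow (τ : ℝ) (S : Fin k → Fin B) (g : Fin k × Fin B → ℝ) :
    ∑ j, g j * supportRow τ S j = τ * ∑ a, g (a, S a) := by
  rw [Fintype.sum_prod_type, Finset.mul_sum]
  refine Finset.sum_congr rfl fun a _ => ?_
  rw [Finset.sum_eq_single (S a)] <;> simp +contextual [supportRow, eq_comm, mul_comm]

section Rows

variable {R : Type*} [Fintype R] [DecidableEq R]

omit [Fintype R] [DecidableEq R] in
theorem sum_row_designMatrix_le {f : ℝ → ℝ} (hf : f 0 = 0) {τ : ℝ} (hτ : 0 ≤ f τ)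
    (γ : R → Bool) (l : R → Fin k → Fin B) (i : R) :
    ∑ j, f (designMatrix τ γ l i j) ≤ k * f τ := by
  unfold designMatrix
  split_ifs
  · exact (sum_supportRow hf τ _).le
  · simp only [Pi.zero_apply, hf, Finset.sum_const_zero]; positivity

theorem sum_col_designMatrix_le {f : ℝ → ℝ} (hf : f 0 = 0) {τ : ℝ} (hτ : 0 ≤ f τ)
    (γ : R → Bool) {l : R → Fin k → Fin B} (hl : l ∈ balanced R k B) (j : Fin k × Fin B) :
    ∑ i, f (designMatrix τ γ l i j) ≤ 2 * k * f τ := by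
  have h1 (i : R) : f (designMatrix τ γ l i j) ≤ if l i j.1 = j.2 then f τ else 0 := by
    unfold designMatrix supportRow
    split_ifs <;> simp_all
  calc _ ≤ ∑ i, if l i j.1 = j.2 then f τ else 0 := Finset.sum_le_sum fun i _ => h1 i
    _ = (Finset.univ.filter fun i => l i j.1 = j.2).card * f τ := by
        rw [← Finset.sum_filter, Finset.sum_const, nsmul_eq_mul]
    _ ≤ _ := by
        gcongr
        exact_mod_cast (Finset.mem_filter.1 hl).2 j.1 j.2

omit [Fintype R] in
theorem designMatrix_update_false (τ : ℝ) (γ : R → Bool) (l : R → Fin k → Fin B) (i : R)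
    (S : Fin k → Fin B) (hγ : γ i = false) :
    designMatrix τ γ (Function.update l i S) = designMatrix τ γ l := by
  ext i' j
  by_cases h : i' = i
  · subst h; simp [designMatrix, hγ]
  · simp [designMatrix, h]

omit [Fintype R] in
theorem designMatrix_update_true (τ : ℝ) (γ : R → Bool) (l : R → Fin k → Fin B) (i : R)
    (S : Fin k → Fin B) :
    designMatrix τ (Function.update γ i true) (Function.update l i S) =
      Function.update (designMatrix τ (Function.update γ i false) l) i (supportRow τ S) := by
  ext i' j
  by_cases h : i' = i
  · subst h; simp [designMatrix]
  · simp [designMatrix, h]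

/-- The columns of block `a` selected by fewer than `2k` rows other than `i`. -/
def freeColumns (l : R → Fin k → Fin B) (i : R) (a : Fin k) : Finset (Fin B) :=
  Finset.univ.filter fun b =>
    ((Finset.univ.erase i).filter fun i' => l i' a = b).card < 2 * k

/-- Given the selections of the other rows, the selection of row `i` is free in each block,
independently of the other blocks, up to avoiding the full columns. -/
theorem filter_update_mem_balanced {l : R → Fin k → Fin B} (hl : l ∈ balanced R k B) (i : R) :
    (Finset.univ.filter fun S => Function.update l i S ∈ balanced R k B) =
      Fintype.piFinset (freeColumns l i) := by
  have hcard (S : Fin k → Fin B) (a : Fin k) (b : Fin B) :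
      (Finset.univ.filter fun i' => Function.update l i S i' a = b).card =
        ((Finset.univ.erase i).filter fun i' => l i' a = b).card + if S a = b then 1 else 0 := by
    rw [← Finset.insert_erase (Finset.mem_univ i), Finset.filter_insert,
      Finset.erase_insert_eq_erase, Finset.erase_idem]
    have : ((Finset.univ.erase i).filter fun i' => Function.update l i S i' a = b) =
        (Finset.univ.erase i).filter fun i' => l i' a = b := by
      refine Finset.filter_congr fun i' hi' => ?_
      rw [Function.update_of_ne (Finset.ne_of_mem_erase hi')]
    simp only [Function.update_self, this]
    split_ifs
    · rw [Finset.card_insert_of_notMem (by simp)]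
    · rfl
  have hle (a : Fin k) (b : Fin B) :
      ((Finset.univ.erase i).filter fun i' => l i' a = b).card ≤ 2 * k :=
    (Finset.card_le_card (Finset.filter_subset_filter _ (Finset.erase_subset _ _))).trans
      ((Finset.mem_filter.1 hl).2 a b)
  ext S
  simp only [Finset.mem_filter, Finset.mem_univ, true_and, balanced, hcard, Fintype.mem_piFinset,
    freeColumns]
  constructor
  · intro h a
    have := h a (S a)
    simp at this
    omega
  · intro h a b
    split_ifs with e
    · subst e; have := h a; omega
    · exact hle a b

/-- At most half of the columns of a block are full, as the `|R| = kB` rows select one each. -/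
theorem le_two_mul_card_freeColumns (hk : 0 < k) (hR : Fintype.card R = k * B)
    (l : R → Fin k → Fin B) (i : R) (a : Fin k) : B ≤ 2 * (freeColumns l i a).card := by
  have h1 : ∑ b, ((Finset.univ.erase i).filter fun i' => l i' a = b).card ≤ k * B := by
    rw [← Finset.card_eq_sum_card_fiberwise (fun x _ => Finset.mem_coe.2 (Finset.mem_univ (l x a))),
      ← hR]
    exact Finset.card_le_univ _
  have h2 : ((freeColumns l i a)ᶜ).card * (2 * k) ≤
      ∑ b, ((Finset.univ.erase i).filter fun i' => l i' a = b).card := by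
    refine le_trans ?_ (Finset.sum_le_univ_sum_of_nonneg (s := (freeColumns l i a)ᶜ) (by simp))
    rw [← smul_eq_mul]
    refine Finset.card_nsmul_le_sum _ _ _ fun b hb => ?_
    simpa [freeColumns] using hb
  have h3 : ((freeColumns l i a)ᶜ).card * 2 ≤ B := by
    refine Nat.le_of_mul_le_mul_left ?_ hk
    calc _ = ((freeColumns l i a)ᶜ).card * (2 * k) := by ring
      _ ≤ _ := h2.trans h1
  have h4 := Finset.card_add_card_compl (freeColumns l i a)
  rw [Fintype.card_fin] at h4
  omega

end Rows

theorem balanced_nonempty (k B : ℕ) : (balanced (Fin k × Fin B) k B).Nonempty := by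
  refine ⟨fun p _ => p.2, Finset.mem_filter.2 ⟨Finset.mem_univ _, fun a b => ?_⟩⟩
  have : (Finset.univ.filter fun p : Fin k × Fin B => p.2 = b) =
      Finset.univ.image fun a => (a, b) := by
    ext ⟨x, y⟩; simp [eq_comm]
  rw [this]
  refine Finset.card_image_le.trans ?_
  simp; omega

/-- The exponential moment of an additive functional of a random selection with independent
coordinates, each uniform on at least half of a block. -/
theorem sum_exp_le_card_mul_exp {A : Fin k → Finset (Fin B)} (hB : 0 < B)
    (hA : ∀ a, B ≤ 2 * (A a).card) {τ : ℝ} (hτ : 0 < τ) {g : Fin k × Fin B → ℝ} (hg0 : ∀ j, 0 ≤ g j)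
    (hg : ∀ j, g j ≤ 2 * τ) (hgs : ∑ j, g j ≤ 2 * (k * τ)) (N : ℕ) :
    ∑ S ∈ Fintype.piFinset A, Real.exp (2 * N * (τ * ∑ a, g (a, S a))) ≤
      (Fintype.piFinset A).card * Real.exp (2 * k / B * Real.exp (4 * N * τ ^ 2)) := by
  obtain ⟨E, hE⟩ : ∃ E, E = Real.exp (4 * N * τ ^ 2) := ⟨_, rfl⟩
  have hE0 : 0 ≤ E := hE ▸ Real.exp_nonneg _
  rw [← hE]
  have hB' : (0 : ℝ) < B := by exact_mod_cast hB
  -- the chord of the exponential function over `[0, 4Nτ²]`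
  have hexp (j) : Real.exp (2 * N * τ * g j) ≤ 1 + g j / (2 * τ) * E := by
    have hθ1 : g j / (2 * τ) ≤ 1 := (div_le_one (by positivity)).2 (hg j)
    have hθ0 : 0 ≤ g j / (2 * τ) := div_nonneg (hg0 j) (by positivity)
    have := convexOn_exp.2 (Set.mem_univ 0) (Set.mem_univ (4 * N * τ ^ 2))
      (sub_nonneg.2 hθ1) hθ0 (by ring)
    simp only [smul_eq_mul, mul_zero, zero_add, Real.exp_zero, mul_one, ← hE] at this
    have e : g j / (2 * τ) * (4 * N * τ ^ 2) = 2 * N * τ * g j := by field_simp; ring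
    rw [e] at this
    linarith
  have hblock (a : Fin k) : ∑ b ∈ A a, Real.exp (2 * N * τ * g (a, b)) ≤
      (A a).card * Real.exp (∑ b, g (a, b) / (τ * B) * E) := by
    have hc : (B : ℝ) ≤ 2 * (A a).card := by exact_mod_cast hA a
    have hc0 : (0 : ℝ) < (A a).card := by linarith
    have h0 (b) : 0 ≤ g (a, b) / (2 * τ) * E :=
      mul_nonneg (div_nonneg (hg0 _) (by positivity)) hE0
    calc _ ≤ ∑ b ∈ A a, (1 + g (a, b) / (2 * τ) * E) := Finset.sum_le_sum fun b _ => hexp _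
      _ = (A a).card + ∑ b ∈ A a, g (a, b) / (2 * τ) * E := by simp [Finset.sum_add_distrib]
      _ ≤ (A a).card + ∑ b, g (a, b) / (2 * τ) * E := by
          have := Finset.sum_le_univ_sum_of_nonneg (s := A a) h0
          linarith
      _ ≤ (A a).card + (A a).card * ∑ b, g (a, b) / (τ * B) * E := by
          gcongr
          rw [Finset.mul_sum]
          refine Finset.sum_le_sum fun b _ => ?_
          have e : g (a, b) / (2 * τ) * E = (B / 2) * (g (a, b) / (τ * B) * E) := by
            field_simp
          rw [e]
          refine mul_le_mul_of_nonneg_right (by linarith) ?_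
          exact mul_nonneg (div_nonneg (hg0 _) (by positivity)) hE0
      _ = (A a).card * (∑ b, g (a, b) / (τ * B) * E + 1) := by ring
      _ ≤ _ := by gcongr; exact Real.add_one_le_exp _
  have e1 (S : Fin k → Fin B) : Real.exp (2 * N * (τ * ∑ a, g (a, S a))) =
      ∏ a, Real.exp (2 * N * τ * g (a, S a)) := by
    rw [← Real.exp_sum, ← Finset.mul_sum]; ring_nf
  simp_rw [e1]
  rw [← Finset.prod_univ_sum A fun a b => Real.exp (2 * N * τ * g (a, b))]
  refine (Finset.prod_le_prod (fun a _ => Finset.sum_nonneg fun b _ => Real.exp_nonneg _)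
    fun a _ => hblock a).trans ?_
  rw [Finset.prod_mul_distrib, Fintype.card_piFinset, Nat.cast_prod, ← Real.exp_sum]
  refine mul_le_mul_of_nonneg_left (Real.exp_le_exp.2 ?_)
    (Finset.prod_nonneg fun a _ => Nat.cast_nonneg _)
  rw [← Fintype.sum_prod_type' fun a b => g (a, b) / (τ * B) * E, ← Finset.sum_mul,
    ← Finset.sum_div]
  refine mul_le_mul_of_nonneg_right ?_ hE0
  rw [div_le_div_iff₀ (by positivity) hB']
  have := mul_le_mul_of_nonneg_right hgs hB'.le
  linarith

end Design

/-! ### The switches cannot be estimated -/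

section DesignLaw

variable {k B : ℕ}

/-- The law of `N` independent centered Gaussian vectors whose cross-correlations are encoded by
`γ` and `l`. -/
def designLaw (N : ℕ) (τ : ℝ) (γ : Fin k × Fin B → Bool) (l : Fin k × Fin B → Fin k → Fin B) :
    Measure (Fin N → EuclideanSpace ℝ (Option ((Fin k × Fin B) ⊕ (Fin k × Fin B)))) :=
  Measure.pi fun _ => multivariateGaussian 0 (crossCov (designMatrix τ γ l))

theorem sum_abs_designMatrix_le {τ : ℝ} (hτ : 0 ≤ τ) (γ : Fin k × Fin B → Bool)
    {l : Fin k × Fin B → Fin k → Fin B} (hl : l ∈ balanced (Fin k × Fin B) k B)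
    (a : Option ((Fin k × Fin B) ⊕ (Fin k × Fin B))) :
    ∑ b, |crossMatrix (designMatrix τ γ l) a b| ≤ 2 * k * τ := by
  have h0 : (0 : ℝ) ≤ k * τ := by positivity
  refine sum_abs_crossMatrix_le (by positivity) (fun i => ?_) (fun j => ?_) a
  · have := sum_row_designMatrix_le (f := fun x => |x|) abs_zero (abs_nonneg τ) γ l i
    rw [abs_of_nonneg hτ] at this
    linarith
  · have := sum_col_designMatrix_le (f := fun x => |x|) abs_zero (abs_nonneg τ) γ hl j
    rwa [abs_of_nonneg hτ] at this

theorem posSemidef_crossCov_designMatrix {τ : ℝ} (hτ : 0 ≤ τ) (hkτ : 2 * k * τ ≤ 1 / 2)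
    (γ : Fin k × Fin B → Bool)
    {l : Fin k × Fin B → Fin k → Fin B} (hl : l ∈ balanced (Fin k × Fin B) k B) :
    (crossCov (designMatrix τ γ l)).PosSemidef :=
  Matrix.posSemidef_one_add (crossMatrix_transpose _) fun a =>
    (sum_abs_designMatrix_le hτ γ hl a).trans (by linarith)

/-- One row at a time: no statistic can tell whether row `i` is switched off, or is switched on with
a random selection of columns. -/
theorem card_mul_le_lintegral_add_sum_designLaw (hk : 0 < k) (hB : 0 < B) {τ : ℝ} (hτ : 0 < τ)
    (hkτ : 2 * k * τ ≤ 1 / 2) (N : ℕ) (i : Fin k × Fin B) (γ : Fin k × Fin B → Bool)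
    {l : Fin k × Fin B → Fin k → Fin B} (hl : l ∈ balanced (Fin k × Fin B) k B) {a : ℝ} (ha : 0 ≤ a)
    {w : (Fin N → EuclideanSpace ℝ (Option ((Fin k × Fin B) ⊕ (Fin k × Fin B)))) → ℝ}
    (hw : AEMeasurable w (designLaw N τ (Function.update γ i false) l)) :
    ((Finset.univ.filter fun S => Function.update l i S ∈ balanced _ k B).card : ℝ≥0∞) *
        ENNReal.ofReal (3 * a / (4 * Real.exp (2 * k / B * Real.exp (4 * N * τ ^ 2)))) ≤
      (Finset.univ.filter fun S => Function.update l i S ∈ balanced _ k B).card *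
        ∫⁻ ω, ‖w ω‖ₑ ∂(designLaw N τ (Function.update γ i false) l) +
      ∑ S ∈ Finset.univ.filter fun S => Function.update l i S ∈ balanced _ k B,
        ∫⁻ ω, ‖w ω - a‖ₑ
          ∂(designLaw N τ (Function.update γ i true) (Function.update l i S)) := by
  have hk' : (1 : ℝ) ≤ k := by exact_mod_cast hk
  set Λ := designMatrix τ (Function.update γ i false) l with hΛ
  have hΛi : Λ i = 0 := by simp [hΛ, designMatrix]
  have hΛE := fun a => (sum_abs_designMatrix_le hτ.le (Function.update γ i false) hl a).trans hkτ
  -- `b S` is the regression vector of row `i` on the others when it selects `S`.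
  choose b hb using fun S : Fin k → Fin B =>
    Matrix.exists_one_add_mulVec_eq hΛE (columnVec (supportRow τ S))
  have hlink (S : Fin k → Fin B) : crossCov (designMatrix τ (Function.update γ i true)
      (Function.update l i S)) = (crossCov Λ).link (some (Sum.inl i))
        (columnVec (supportRow τ S)) := by
    rw [designMatrix_update_true, crossCov_update hΛi]
  have hv (S : Fin k → Fin B) (c : Option ((Fin k × Fin B) ⊕ (Fin k × Fin B))) :
      |columnVec (supportRow τ S) c| ≤ τ := by
    rcases c with _ | c | c
    · simpa [columnVec] using hτ.le
    · simpa [columnVec] using hτ.le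
    · simp only [columnVec, supportRow]
      split_ifs
      · rw [abs_of_pos hτ]
      · simpa using hτ.le
  have hbi (S : Fin k → Fin B) : b S (some (Sum.inl i)) = 0 := by
    have := congrFun (hb S) (some (Sum.inl i))
    rw [Matrix.mulVec, ← crossCov, crossCov_row_of_eq_zero hΛi, single_one_dotProduct] at this
    rw [this]; rfl
  have hbmax (S : Fin k → Fin B) (c) : |b S c| ≤ 2 * τ :=
    Matrix.abs_le_of_one_add_mulVec_eq hΛE (hb S) (hv S) c
  have hbsum (S : Fin k → Fin B) : ∑ c, |b S c| ≤ 2 * (k * τ) := by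
    refine (Matrix.sum_abs_le_of_one_add_mulVec_eq (crossMatrix_transpose _) hΛE (hb S)).trans_eq ?_
    have := sum_supportRow (f := fun x => |x|) abs_zero τ S
    rw [abs_of_pos hτ] at this
    simp [Fintype.sum_option, columnVec, this]
  set g : (Fin k → Fin B) → Fin k × Fin B → ℝ := fun T j => |b T (some (Sum.inr j))| with hg
  have hgsum (T) : ∑ j, g T j ≤ 2 * (k * τ) := by
    refine le_trans ?_ (hbsum T)
    rw [Fintype.sum_option, Fintype.sum_sum_type]
    have h1 : 0 ≤ ∑ x : Fin k × Fin B, |b T (some (Sum.inl x))| :=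
      Finset.sum_nonneg fun _ _ => abs_nonneg _
    have h2 := abs_nonneg (b T none)
    simp only [hg]
    linarith
  have hF := filter_update_mem_balanced hl i
  have hcard := le_two_mul_card_freeColumns hk (R := Fin k × Fin B) (by simp) l i
  have hne : (Finset.univ.filter fun S => Function.update l i S ∈ balanced _ k B).Nonempty :=
    ⟨l i, by simpa using hl⟩
  have main := card_mul_le_lintegral_add_sum_link (N := N) (Q := crossCov Λ)
    (i := some (Sum.inl i))
    (Finset.univ.filter fun S => Function.update l i S ∈ balanced (Fin k × Fin B) k B) hne
    (v := fun S => columnVec (supportRow τ S)) (b := b)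
    (posSemidef_crossCov_designMatrix hτ.le hkτ _ hl)
    (fun S hS => by
      rw [← hlink]
      exact posSemidef_crossCov_designMatrix hτ.le hkτ _ (Finset.mem_filter.1 hS).2)
    (crossCov_row_of_eq_zero hΛi) (fun S _ => rfl) (fun S _ => hbi S) (fun S _ => hb S)
    (ρ := fun S T => τ * ∑ a, g T (a, S a))
    (fun S _ T _ => ?_) (fun S _ T _ => ?_) (fun S _ T _ => ?_)
    (χ := Real.exp (2 * k / B * Real.exp (4 * N * τ ^ 2)))
    (Real.one_le_exp (by positivity)) (fun T _ => ?_) (w := w) hw ha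
  · simp only [← hlink] at main
    exact main
  · have : b T ⬝ᵥ columnVec (supportRow τ S) =
        ∑ j, b T (some (Sum.inr j)) * supportRow τ S j := by
      simp [dotProduct, Fintype.sum_option, columnVec]
    rw [this, sum_mul_supportRow τ S fun j => b T (some (Sum.inr j))]
    gcongr
    exact le_abs_self _
  · exact mul_nonneg hτ.le (Finset.sum_nonneg fun _ _ => abs_nonneg _)
  · have : ∑ a, g T (a, S a) ≤ ∑ a : Fin k, 2 * τ := Finset.sum_le_sum fun _ _ => hbmax T _
    simp only [Finset.sum_const, Finset.card_univ, Fintype.card_fin, nsmul_eq_mul] at this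
    have h2 := mul_le_mul_of_nonneg_left this hτ.le
    have h3 : τ * (k * (2 * τ)) ≤ τ * (1 / 2) := by gcongr; linarith
    have h4 : 1 * τ ≤ k * τ := by gcongr
    linarith
  · rw [hF]
    exact sum_exp_le_card_mul_exp hB hcard hτ (fun j => abs_nonneg _) (fun j => hbmax T _)
      (hgsum T) N

/-- However the switches `γ`, scaled by `a`, are estimated, some design makes the `ℓ¹` risk as large
as stated, since the average risk over all `γ` and all balanced `l` is. -/
theorem exists_le_sum_lintegral_designLaw (hk : 0 < k) (hB : 0 < B) {τ : ℝ} (hτ : 0 < τ)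
    (hkτ : 2 * k * τ ≤ 1 / 2) (N : ℕ) {a : ℝ} (ha : 0 ≤ a)
    {w : Fin k × Fin B →
      (Fin N → EuclideanSpace ℝ (Option ((Fin k × Fin B) ⊕ (Fin k × Fin B)))) → ℝ}
    (hw : ∀ i γ, ∀ l ∈ balanced (Fin k × Fin B) k B, AEMeasurable (w i) (designLaw N τ γ l)) :
    ∃ γ, ∃ l ∈ balanced (Fin k × Fin B) k B,
      ENNReal.ofReal (k * B *
        (3 * a / (8 * Real.exp (2 * k / B * Real.exp (4 * N * τ ^ 2))))) ≤
      ∑ i, ∫⁻ ω, ‖w i ω - if γ i then a else 0‖ₑ ∂(designLaw N τ γ l) := by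
  set χ := Real.exp (2 * k / B * Real.exp (4 * N * τ ^ 2))
  have hχ : 0 < χ := Real.exp_pos _
  set D := balanced (Fin k × Fin B) k B
  set r : Fin k × Fin B → (Fin k × Fin B → Bool) → (Fin k × Fin B → Fin k → Fin B) → ℝ≥0∞ :=
    fun i γ l => ∫⁻ ω, ‖w i ω - if γ i then a else 0‖ₑ ∂(designLaw N τ γ l) with hr
  have key (i) := card_mul_le_sum_of_update D i (r i) (ENNReal.ofReal (3 * a / (4 * χ)))
    (fun γ l S hγ => by simp only [hr, designLaw, designMatrix_update_false τ γ l i S hγ])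
    (fun γ l hl => by
      simpa [hr] using card_mul_le_lintegral_add_sum_designLaw hk hB hτ hkτ N i γ hl ha
        (hw i _ l hl))
  by_contra! hcon
  have hne : (Finset.univ ×ˢ D : Finset ((Fin k × Fin B → Bool) × _)).Nonempty :=
    Finset.univ_nonempty.product (balanced_nonempty k B)
  have hlt := ENNReal.sum_lt_sum_of_nonempty hne
    (f := fun p : (Fin k × Fin B → Bool) × (Fin k × Fin B → Fin k → Fin B) => ∑ i, r i p.1 p.2)
    fun p hp => hcon p.1 p.2 (Finset.mem_product.1 hp).2
  have hsum := Finset.sum_le_sum fun i (_ : i ∈ Finset.univ) => key i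
  have h1 : ∑ i, 2 * ∑ γ, ∑ l ∈ D, r i γ l = 2 * ∑ p ∈ Finset.univ ×ˢ D, ∑ i, r i p.1 p.2 := by
    rw [← Finset.mul_sum, Finset.sum_comm (s := Finset.univ ×ˢ D)]
    simp_rw [Finset.sum_product]
  rw [h1] at hsum
  have h2 := ENNReal.mul_lt_mul_right (a := 2) (by simp) (by simp) hlt
  refine (hsum.trans_lt h2).ne ?_
  simp only [Finset.sum_const, Finset.card_univ, Fintype.card_prod, Fintype.card_fin, nsmul_eq_mul,
    Finset.card_product]
  have e : 2 * ENNReal.ofReal (k * B * (3 * a / (8 * χ))) =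
      ((k * B : ℕ) : ℝ≥0∞) * ENNReal.ofReal (3 * a / (4 * χ)) := by
    rw [← ENNReal.ofReal_natCast, ← ENNReal.ofReal_ofNat 2, ← ENNReal.ofReal_mul (by norm_num),
      ← ENNReal.ofReal_mul (by positivity)]
    congr 1
    push_cast
    field_simp
    ring
  rw [Nat.cast_mul (Fintype.card _) D.card, mul_left_comm 2, e]
  ring

end DesignLaw

/-! ### Finite-rank operators on orthogonal vectors -/

section KernelSum

variable {ι H : Type*} [Fintype ι] [NormedAddCommGroup H] [InnerProductSpace ℝ H]

/-- The finite-rank operator `ψ ↦ ∑ A a b ⟨e b, ψ⟩ e a`. -/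
def kernelSum (A : Matrix ι ι ℝ) (e : ι → H) : H →L[ℝ] H :=
  ∑ a, ∑ b, A a b • (innerSL ℝ (e b)).smulRight (e a)

theorem kernelSum_apply (A : Matrix ι ι ℝ) (e : ι → H) (ψ : H) :
    kernelSum A e ψ = ∑ a, (∑ b, A a b * inner ℝ (e b) ψ) • e a := by
  simp [kernelSum, Finset.sum_smul, smul_smul]

theorem inner_kernelSum (A : Matrix ι ι ℝ) (e : ι → H) (φ ψ : H) :
    inner ℝ φ (kernelSum A e ψ) = ∑ a, ∑ b, A a b * inner ℝ (e a) φ * inner ℝ (e b) ψ := by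
  rw [kernelSum_apply, inner_sum]
  refine Finset.sum_congr rfl fun a _ => ?_
  rw [inner_smul_right, real_inner_comm, Finset.sum_mul]
  exact Finset.sum_congr rfl fun b _ => by ring

variable [DecidableEq ι] {e : ι → H} {W : ι → ℝ}

/-- Pythagoras. -/
theorem norm_sum_smul_sq (he : ∀ a b, inner ℝ (e a) (e b) = if a = b then W a else 0) (z : ι → ℝ) :
    ‖∑ a, z a • e a‖ ^ 2 = ∑ a, z a ^ 2 * W a := by
  rw [← real_inner_self_eq_norm_sq, sum_inner]
  refine Finset.sum_congr rfl fun a _ => ?_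
  rw [inner_sum]
  simp only [inner_smul_left, inner_smul_right, he]
  simp
  ring

/-- Bessel's inequality. -/
theorem sum_inner_sq_div_le (he : ∀ a b, inner ℝ (e a) (e b) = if a = b then W a else 0)
    (hW : ∀ a, 0 < W a) (φ : H) : ∑ a, inner ℝ (e a) φ ^ 2 / W a ≤ ‖φ‖ ^ 2 := by
  have h1 := norm_sum_smul_sq he fun a => inner ℝ (e a) φ / W a
  have h2 : inner ℝ φ (∑ a, (inner ℝ (e a) φ / W a) • e a) = ∑ a, inner ℝ (e a) φ ^ 2 / W a := by
    rw [inner_sum]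
    refine Finset.sum_congr rfl fun a _ => ?_
    rw [inner_smul_right, real_inner_comm]; ring
  have h3 : ∑ a, (inner ℝ (e a) φ / W a) ^ 2 * W a = ∑ a, inner ℝ (e a) φ ^ 2 / W a :=
    Finset.sum_congr rfl fun a _ => by have := (hW a).ne'; field_simp
  have h4 := norm_sub_sq_real φ (∑ a, (inner ℝ (e a) φ / W a) • e a)
  rw [h2, h1, h3] at h4
  linarith [sq_nonneg ‖φ - ∑ a, (inner ℝ (e a) φ / W a) • e a‖]

/-- Schur's test. -/
theorem norm_kernelSum_le (he : ∀ a b, inner ℝ (e a) (e b) = if a = b then W a else 0)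
    (hW : ∀ a, 0 < W a) {A : Matrix ι ι ℝ} (hA : A.transpose = A) {K : ℝ} (hK : 0 < K)
    (h : ∀ a, ∑ b, |A a b| * W b ≤ K) : ‖kernelSum A e‖ ≤ K := by
  have hsym : ∀ a b, |A b a| = |A a b| := fun a b => by
    conv_rhs => rw [← hA]
    rfl
  have hdiag (φ : H) : ∑ a, ∑ b, |A a b| * W b * (inner ℝ (e a) φ ^ 2 / W a) ≤ K * ‖φ‖ ^ 2 := by
    refine le_trans ?_ (mul_le_mul_of_nonneg_left (sum_inner_sq_div_le he hW φ) hK.le)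
    rw [Finset.mul_sum]
    refine Finset.sum_le_sum fun a _ => ?_
    rw [← Finset.sum_mul]
    exact mul_le_mul_of_nonneg_right (h a) (div_nonneg (sq_nonneg _) (hW a).le)
  -- The arithmetic-geometric mean inequality, weighted by `W`, bounds the bilinear form.
  have hbil (φ ψ : H) : inner ℝ φ (kernelSum A e ψ) ≤ K / 2 * (‖φ‖ ^ 2 + ‖ψ‖ ^ 2) := by
    have hψ := hdiag ψ
    rw [Finset.sum_comm] at hψ
    have : inner ℝ φ (kernelSum A e ψ) ≤
        ∑ a, ∑ b, (|A a b| * W b * (inner ℝ (e a) φ ^ 2 / W a) +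
          |A b a| * W a * (inner ℝ (e b) ψ ^ 2 / W b)) / 2 := by
      rw [inner_kernelSum]
      refine Finset.sum_le_sum fun a _ => Finset.sum_le_sum fun b _ => ?_
      set x := inner ℝ (e a) φ
      set y := inner ℝ (e b) ψ
      have ha := hW a
      have hb := hW b
      have h1 : A a b * x * y ≤ |A a b| * (|x| * |y|) := by
        rw [← abs_mul, ← abs_mul, mul_assoc]; exact le_abs_self _
      have h2 : 2 * (|x| * |y|) ≤ W b * (x ^ 2 / W a) + W a * (y ^ 2 / W b) := by
        have : W b * (x ^ 2 / W a) + W a * (y ^ 2 / W b) - 2 * (|x| * |y|) =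
            (W b * |x| - W a * |y|) ^ 2 / (W a * W b) := by
          rw [← sq_abs x, ← sq_abs y]; field_simp; ring
        have h3 : 0 ≤ (W b * |x| - W a * |y|) ^ 2 / (W a * W b) := by positivity
        linarith
      have h3 := mul_le_mul_of_nonneg_left h2 (abs_nonneg (A a b))
      rw [hsym a b]
      linarith
    refine this.trans ?_
    simp only [← Finset.sum_div, Finset.sum_add_distrib]
    linarith [hdiag φ]
  refine ContinuousLinearMap.opNorm_le_bound _ hK.le fun ψ => ?_
  -- This choice of `φ` balances the two squares.
  have h1 := hbil (K⁻¹ • kernelSum A e ψ) ψ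
  rw [inner_smul_left, real_inner_self_eq_norm_sq, norm_smul, Real.norm_of_nonneg (by positivity)]
    at h1
  simp only [map_inv₀, conj_trivial] at h1
  refine (sq_le_sq₀ (norm_nonneg _) (by positivity)).1 ?_
  have e1 : K / 2 * ((K⁻¹ * ‖kernelSum A e ψ‖) ^ 2 + ‖ψ‖ ^ 2) =
      (K⁻¹ * ‖kernelSum A e ψ‖ ^ 2) / 2 + K / 2 * ‖ψ‖ ^ 2 := by
    field_simp
  rw [e1] at h1
  have h2 : K⁻¹ * ‖kernelSum A e ψ‖ ^ 2 ≤ K * ‖ψ‖ ^ 2 := by linarith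
  rw [inv_mul_le_iff₀ hK] at h2
  linarith

theorem kernelSum_apply_self (he : ∀ a b, inner ℝ (e a) (e b) = if a = b then W a else 0)
    {A : Matrix ι ι ℝ} {o : ι} (ho : ∀ a, A a o = if a = o then 1 else 0) :
    kernelSum A e (e o) = W o • e o := by
  simp [kernelSum_apply, he, ho]

/-- Testing an operator against orthogonal vectors: the `ℓ¹`-sum of the pairings of `G (∑ e b)` with
the `e a` is controlled by the operator norm of `G`. -/
theorem sum_abs_inner_le (he : ∀ a b, inner ℝ (e a) (e b) = if a = b then W a else 0)
    (G : H →L[ℝ] H) (s t : Finset ι) {w : ℝ} (hs : ∑ a ∈ s, W a ≤ w) (ht : ∑ b ∈ t, W b ≤ w) :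
    ∑ a ∈ s, |inner ℝ (e a) (G (∑ b ∈ t, e b))| ≤ w * ‖G‖ := by
  have hnorm (u : Finset ι) (z : ι → ℝ) (hz : ∀ a, z a ^ 2 ≤ 1) (hW : ∀ a, 0 ≤ W a)
      (hu : ∑ a ∈ u, W a ≤ w) : ‖∑ a ∈ u, z a • e a‖ ≤ √w := by
    apply Real.le_sqrt_of_sq_le
    have h1 : ∑ a ∈ u, z a • e a = ∑ a, (if a ∈ u then z a else 0) • e a := by
      simp [ite_smul]
    rw [h1, norm_sum_smul_sq he]
    refine le_trans ?_ hu
    rw [← Finset.sum_filter_add_sum_filter_not Finset.univ (· ∈ u)]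
    rw [Finset.sum_eq_zero (s := Finset.univ.filter (· ∉ u)) fun a ha => by
      simp [(Finset.mem_filter.1 ha).2], add_zero]
    simp only [Finset.filter_mem_eq_inter, Finset.univ_inter]
    refine Finset.sum_le_sum fun a ha => ?_
    simp only [ha, if_true]
    exact mul_le_of_le_one_left (hW a) (hz a)
  have hW : ∀ a, 0 ≤ W a := fun a => by
    have := he a a
    rw [if_pos rfl, real_inner_self_eq_norm_sq] at this
    rw [← this]; positivity
  set ψ := ∑ b ∈ t, e b with hψ
  have hψn : ‖ψ‖ ≤ √w := by simpa [hψ] using hnorm t (fun _ => 1) (by simp) hW ht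
  set σ : ι → ℝ := fun a => SignType.sign (inner ℝ (e a) (G ψ)) with hσ
  have hσ1 : ∀ a, σ a ^ 2 ≤ 1 := fun a => by
    simp only [hσ]
    rcases SignType.sign (inner ℝ (e a) (G ψ)) with _ | _ | _ <;> simp
  have hw : 0 ≤ w := (Finset.sum_nonneg fun a _ => hW a).trans hs
  calc ∑ a ∈ s, |inner ℝ (e a) (G ψ)| = inner ℝ (∑ a ∈ s, σ a • e a) (G ψ) := by
        rw [sum_inner]
        refine Finset.sum_congr rfl fun a _ => ?_
        rw [inner_smul_left]
        simp [hσ, sign_mul_self]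
    _ ≤ ‖∑ a ∈ s, σ a • e a‖ * ‖G ψ‖ := real_inner_le_norm _ _
    _ ≤ √w * (‖G‖ * √w) := by
        gcongr
        · exact hnorm s σ hσ1 hW hs
        · exact (G.le_opNorm ψ).trans (by gcongr)
    _ = w * ‖G‖ := by
        rw [mul_comm ‖G‖, ← mul_assoc, Real.mul_self_sqrt hw]

end KernelSum

/-! ### Cells of the cube -/

section Cells

/-- The index in `{0, …, K - 1}` of the cell of the regular grid of mesh `1 / K` containing `x`. -/
def gridCell (K : ℕ) (hK : 0 < K) (x : unitInterval) : Fin K :=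
  ⟨min ⌊(K : ℝ) * x⌋₊ (K - 1), by omega⟩

theorem measurable_gridCell (K : ℕ) (hK : 0 < K) : Measurable (gridCell K hK) := by
  refine measurable_to_countable' fun j => ?_
  have : gridCell K hK ⁻¹' {j} =
      (fun x : unitInterval => min ⌊(K : ℝ) * x⌋₊ (K - 1)) ⁻¹' {j.1} := by
    ext x; simp [gridCell, Fin.ext_iff]
  rw [this]
  refine measurableSet_preimage ?_ (measurableSet_singleton _)
  exact (Nat.measurable_floor.comp (by fun_prop)).min measurable_const

theorem volume_gridCell_preimage (K : ℕ) (hK : 0 < K) (j : Fin K) :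
    volume (gridCell K hK ⁻¹' {j}) = ENNReal.ofReal (1 / K) := by
  have hK' : (0 : ℝ) < K := by exact_mod_cast hK
  have hj : ((j : ℕ) : ℝ) + 1 ≤ K := by exact_mod_cast j.2
  have hlen : ((j : ℝ) + 1) / K - j / K = 1 / K := by ring
  rw [unitInterval.volume_apply]
  apply le_antisymm
  · calc _ ≤ volume (Set.Icc ((j : ℝ) / K) ((j + 1) / K)) := by
          refine measure_mono ?_
          rintro _ ⟨x, hx, rfl⟩
          have hx' : min ⌊(K : ℝ) * x⌋₊ (K - 1) = j := by
            simpa [gridCell, Fin.ext_iff] using hx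
          have h1 : (j : ℕ) ≤ ⌊(K : ℝ) * x⌋₊ := by omega
          have h2 : (j : ℝ) ≤ K * x :=
            (Nat.cast_le.2 h1).trans (Nat.floor_le (mul_nonneg hK'.le x.2.1))
          refine ⟨(div_le_iff₀' hK').2 h2, (le_div_iff₀' hK').2 ?_⟩
          by_cases h3 : ⌊(K : ℝ) * x⌋₊ = j
          · exact (h3 ▸ Nat.lt_floor_add_one ((K : ℝ) * x)).le
          · have h4 : (j : ℕ) + 1 = K := by omega
            have h5 : (K : ℝ) * x ≤ K * 1 := by gcongr; exact x.2.2
            have h6 : ((j : ℕ) : ℝ) + 1 = K := by exact_mod_cast h4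
            linarith
      _ = _ := by rw [Real.volume_Icc, hlen]
  · calc _ = volume (Set.Ioo ((j : ℝ) / K) ((j + 1) / K)) := by rw [Real.volume_Ioo, hlen]
      _ ≤ _ := by
        refine measure_mono fun y hy => ?_
        have h1 : (j : ℝ) < K * y := (div_lt_iff₀' hK').1 hy.1
        have h2 : K * y < j + 1 := (lt_div_iff₀' hK').1 hy.2
        have hj0 : (0 : ℝ) ≤ j := by positivity
        have hy0 : 0 ≤ y := by
          by_contra! h
          nlinarith
        have hy1 : y ≤ 1 := by
          by_contra! h
          nlinarith
        refine ⟨⟨y, hy0, hy1⟩, ?_, rfl⟩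
        have h3 : ⌊(K : ℝ) * y⌋₊ = j := (Nat.floor_eq_iff (by positivity)).2 ⟨h1.le, h2⟩
        have h4 := j.2
        simp only [gridCell, Set.mem_preimage, Set.mem_singleton_iff, Fin.ext_iff, h3]
        omega

/-- The cube can be partitioned into measurable cells of equal volume but for one, four times as
large. -/
theorem exists_cells (d : ℕ) (hd : 1 ≤ d) (κ : Type) [Fintype κ] [DecidableEq κ] :
    ∃ c : Cube d → Option κ, (∀ a, MeasurableSet (c ⁻¹' {a})) ∧ ∀ a, volume (c ⁻¹' {a}) =
      ENNReal.ofReal ((if a = none then 4 else 1) / (Fintype.card κ + 4 : ℕ)) := by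
  set K := Fintype.card κ + 4 with hKd
  have hK : 0 < K := by omega
  have eK : Fintype.card (Fin K) = Fintype.card (κ ⊕ Fin 4) := by simp [hKd]
  let ε : Fin K ≃ κ ⊕ Fin 4 := Fintype.equivOfCardEq eK
  -- A grid of `|κ| + 4` slabs in the first coordinate; the last four are merged.
  let f : Fin K → Option κ := fun j => (ε j).getLeft?
  let g : Cube d → Fin K := fun x => gridCell K hK (x ⟨0, hd⟩)
  have hg : Measurable g := (measurable_gridCell K hK).comp (measurable_pi_apply _)
  have hgv (j : Fin K) : volume (g ⁻¹' {j}) = ENNReal.ofReal (1 / K) := by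
    have := (measurePreserving_eval (fun _ : Fin d => (volume : Measure unitInterval))
      ⟨0, hd⟩).measure_preimage ((measurable_gridCell K hK)
        (measurableSet_singleton j)).nullMeasurableSet
    rw [← volume_gridCell_preimage K hK j, ← this]
    rfl
  have hpre (a : Option κ) : (f ∘ g) ⁻¹' {a} =
      ⋃ j ∈ Finset.univ.filter fun j => f j = a, g ⁻¹' {j} := by
    ext x; simp
  refine ⟨f ∘ g, fun a => hpre a ▸ Finset.measurableSet_biUnion _ fun j _ =>
    hg (measurableSet_singleton j), fun a => ?_⟩
  rw [hpre, measure_biUnion_finset (fun j _ j' _ hjj' => by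
    refine Set.disjoint_left.2 fun x hx hx' => hjj' ?_
    simp only [Set.mem_preimage, Set.mem_singleton_iff] at hx hx'
    rw [← hx, hx']) fun j _ => hg (measurableSet_singleton j)]
  simp only [hgv, Finset.sum_const, nsmul_eq_mul]
  have hcard : (Finset.univ.filter fun j => f j = a).card = if a = none then 4 else 1 := by
    have : (Finset.univ.filter fun j => f j = a) =
        (Finset.univ.filter fun s : κ ⊕ Fin 4 => s.getLeft? = a).map ε.symm.toEmbedding := by
      ext j; simp [f]
    rw [this, Finset.card_map]
    rcases a with _ | a
    · have : (Finset.univ.filter fun s : κ ⊕ Fin 4 => s.getLeft? = none) =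
          Finset.univ.map Function.Embedding.inr := by
        ext s; rcases s with s | s <;> simp
      rw [this]; simp
    · have : (Finset.univ.filter fun s : κ ⊕ Fin 4 => s.getLeft? = some a) = {Sum.inl a} := by
        ext s; rcases s with s | s <;> simp
      rw [this]; simp
  rw [hcard, ← ENNReal.ofReal_natCast, ← ENNReal.ofReal_mul (by positivity)]
  congr 1
  split_ifs <;> push_cast <;> ring

end Cells

/-! ### Gaussian processes constant on cells -/

section StepModel

variable {d : ℕ} {ι : Type} [Fintype ι] [DecidableEq ι]

theorem sum_indicator_preimage_singleton {α ι β : Type*} [Fintype ι] [AddCommMonoid β] (c : α → ι)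
    (f : ι → α → β) (x : α) : ∑ a, (c ⁻¹' {a}).indicator (f a) x = f (c x) x := by
  rw [Finset.sum_eq_single (c x) (fun a _ h => Set.indicator_of_notMem (by simpa using h.symm) _)
    (by simp)]
  exact Set.indicator_of_mem (by simp) _

omit [DecidableEq ι] in
theorem eval_cell_eq_sum_indicator (c : Cube d → ι) :
    (fun p : Cube d × EuclideanSpace ℝ ι => p.2 (c p.1)) =
      fun p => ∑ a, ((fun p : Cube d × EuclideanSpace ℝ ι => p.1) ⁻¹' (c ⁻¹' {a})).indicator
        (fun p => p.2 a) p := by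
  ext p
  exact (sum_indicator_preimage_singleton (fun p : Cube d × EuclideanSpace ℝ ι => c p.1)
    (fun a p => p.2 a) p).symm

theorem memLp_eval_multivariateGaussian (A : Matrix ι ι ℝ) (a : ι) :
    MemLp (fun ω : EuclideanSpace ℝ ι => ω a) 2 (multivariateGaussian 0 A) :=
  ((IsGaussian.hasGaussianLaw_id (μ := multivariateGaussian 0 A)).map_fun
    (EuclideanSpace.proj a)).memLp_two

theorem integral_eval_multivariateGaussian (A : Matrix ι ι ℝ) (a : ι) :
    ∫ ω : EuclideanSpace ℝ ι, ω a ∂(multivariateGaussian 0 A) = 0 := by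
  have := (EuclideanSpace.proj a : EuclideanSpace ℝ ι →L[ℝ] ℝ).integral_comp_id_comm
    (μ := multivariateGaussian 0 A) IsGaussian.integrable_id
  simpa using this

/-- The process that is constant on the cells `c ⁻¹' {a}`, with jointly Gaussian values of
covariance matrix `A`. The sample space consists of the vectors of values, and is thus the same for
all `A`. -/
def stepModel (c : Cube d → ι) (hc : ∀ a, MeasurableSet (c ⁻¹' {a})) (A : Matrix ι ι ℝ) :
    GaussianModel d where
  Ω := EuclideanSpace ℝ ι
  P := multivariateGaussian 0 A
  u x ω := ω (c x)
  measurable_u := by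
    change Measurable fun p : Cube d × EuclideanSpace ℝ ι => p.2 (c p.1)
    rw [eval_cell_eq_sum_indicator]
    exact Finset.measurable_fun_sum _ fun a _ =>
      Measurable.indicator (by fun_prop) (measurable_fst (hc a))
  gaussian := by
    refine ⟨fun I => ?_⟩
    let L : EuclideanSpace ℝ ι →L[ℝ] (I → ℝ) :=
      ContinuousLinearMap.pi fun x => EuclideanSpace.proj (c x)
    exact (IsGaussian.hasGaussianLaw_id (μ := multivariateGaussian 0 A)).map_fun L
  centered x := integral_eval_multivariateGaussian A (c x)
  squareIntegrable := by
    change MemLp (fun p : Cube d × EuclideanSpace ℝ ι => p.2 (c p.1)) 2 _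
    rw [eval_cell_eq_sum_indicator]
    refine memLp_finsetSum _ fun a _ => MemLp.indicator (measurable_fst (hc a)) ?_
    exact (memLp_eval_multivariateGaussian A a).comp_snd _

variable {c : Cube d → ι} (hc : ∀ a, MeasurableSet (c ⁻¹' {a})) {A : Matrix ι ι ℝ}

theorem kernel_stepModel (hA : A.PosSemidef) (x y : Cube d) :
    (stepModel c hc A).kernel x y = A (c x) (c y) := by
  have h := covariance_eval_multivariateGaussian (μ := 0) hA (c x) (c y)
  rw [covariance_eq_sub (memLp_eval_multivariateGaussian A _)
    (memLp_eval_multivariateGaussian A _), integral_eval_multivariateGaussian, zero_mul,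
    sub_zero] at h
  exact h

/-- The indicator function of a cell, in `L²`. -/
def cellVec (a : ι) : L2Cube d := indicatorConstLp 2 (hc a) (measure_ne_top _ _) (1 : ℝ)

omit [Fintype ι] in
theorem inner_cellVec (a b : ι) : inner ℝ (cellVec hc a) (cellVec hc b) =
    if a = b then volume.real (c ⁻¹' {a}) else 0 := by
  rw [cellVec, cellVec, L2.real_inner_indicatorConstLp_one_indicatorConstLp_one]
  split_ifs with h
  · rw [h, Set.inter_self]
  · have : c ⁻¹' {a} ∩ c ⁻¹' {b} = ∅ := by
      ext x; simp only [Set.mem_inter_iff, Set.mem_preimage, Set.mem_singleton_iff,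
        Set.mem_empty_iff_false, iff_false]
      rintro ⟨h1, h2⟩; exact h (h1 ▸ h2)
    rw [this, measureReal_empty]

omit [DecidableEq ι] in
theorem isIntegralOperator_kernelSum (A : Matrix ι ι ℝ) :
    IsIntegralOperator (fun x y => A (c x) (c y)) (kernelSum A (cellVec hc)) := by
  intro ψ
  have h1 : ∀ᵐ x : Cube d, ∀ a, cellVec hc a x = (c ⁻¹' {a}).indicator (fun _ => (1 : ℝ)) x :=
    ae_all_iff.2 fun a => indicatorConstLp_coeFn
  have h2 : ⇑(kernelSum A (cellVec hc) ψ) =ᵐ[volume]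
      fun x => ∑ a, (∑ b, A a b * inner ℝ (cellVec hc b) ψ) * cellVec hc a x := by
    rw [kernelSum_apply]
    have h3 := Lp.coeFn_finsetSum Finset.univ
      (fun a => (∑ b, A a b * inner ℝ (cellVec hc b) ψ) • cellVec hc a)
    have h4 : ∀ᵐ x : Cube d, ∀ a, ((∑ b, A a b * inner ℝ (cellVec hc b) ψ) • cellVec hc a) x =
        (∑ b, A a b * inner ℝ (cellVec hc b) ψ) * cellVec hc a x :=
      ae_all_iff.2 fun a => by
        filter_upwards [Lp.coeFn_smul (∑ b, A a b * inner ℝ (cellVec hc b) ψ) (cellVec hc a)]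
          with x hx
        rw [hx]; rfl
    filter_upwards [h3, h4] with x hx hx'
    rw [hx, Finset.sum_apply]
    exact Finset.sum_congr rfl fun a _ => hx' a
  have hint : Integrable ψ volume := (Lp.memLp ψ).integrable (by norm_num)
  filter_upwards [h1, h2] with x hx1 hx2
  rw [hx2]
  have e1 : ∑ a, (∑ b, A a b * inner ℝ (cellVec hc b) ψ) * cellVec hc a x =
      ∑ b, A (c x) b * inner ℝ (cellVec hc b) ψ := by
    simp only [hx1, ← Set.indicator_const_mul]
    rw [sum_indicator_preimage_singleton c (fun a _ => (∑ b, A a b * inner ℝ (cellVec hc b) ψ) * 1),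
      mul_one]
  have e2 : (fun y => A (c x) (c y) * ψ y) =
      fun y => ∑ b, A (c x) b * (c ⁻¹' {b}).indicator ψ y := by
    ext y
    simp only [← Set.indicator_const_mul]
    exact (sum_indicator_preimage_singleton c (fun b y => A (c x) b * ψ y) y).symm
  rw [e1, e2, integral_finsetSum _ fun b _ => (hint.indicator (hc b)).const_mul _]
  refine Finset.sum_congr rfl fun b _ => ?_
  rw [integral_const_mul, integral_indicator (hc b), cellVec, L2.inner_indicatorConstLp_one]

theorem IsIntegralOperator.integralOperator_eq {k : Cube d → Cube d → ℝ}
    {C : L2Cube d →L[ℝ] L2Cube d} (h : IsIntegralOperator k C) : integralOperator k = C := by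
  have hex : ∃ C, IsIntegralOperator k C := ⟨C, h⟩
  rw [integralOperator, dif_pos hex]
  exact hex.choose_spec.unique h

theorem covOp_stepModel (hA : A.PosSemidef) :
    (stepModel c hc A).covOp = kernelSum A (cellVec hc) := by
  have h : (stepModel c hc A).kernel = fun x y => A (c x) (c y) := by
    ext x y; exact kernel_stepModel hc hA x y
  rw [GaussianModel.covOp, h]
  exact (isIntegralOperator_kernelSum hc A).integralOperator_eq

omit [DecidableEq ι] in
/-- For a kernel constant on products of cells, `‖k‖_q^q` is the largest weighted row sum. -/
theorem kernelLq_le (hc : ∀ a, MeasurableSet (c ⁻¹' {a})) {q K : ℝ} (hq : 0 < q)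
    (h : ∀ a, ∑ b, |A a b| ^ q * volume.real (c ⁻¹' {b}) ≤ K) :
    kernelLq q (fun x y => A (c x) (c y)) ≤ ENNReal.ofReal K := by
  refine iSup_le fun x => ?_
  have e : (fun y => ‖A (c x) (c y)‖ₑ ^ q) = fun y => ∑ b, (c ⁻¹' {b}).indicator
      (fun _ => ENNReal.ofReal (|A (c x) b| ^ q)) y := by
    ext y
    rw [Real.enorm_eq_ofReal_abs, ENNReal.ofReal_rpow_of_nonneg (abs_nonneg _) hq.le]
    exact (sum_indicator_preimage_singleton c
      (fun b _ => ENNReal.ofReal (|A (c x) b| ^ q)) y).symm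
  rw [e, lintegral_finsetSum _ fun b _ => measurable_const.indicator (hc b)]
  calc _ = ∑ b, ENNReal.ofReal (|A (c x) b| ^ q * volume.real (c ⁻¹' {b})) := by
        refine Finset.sum_congr rfl fun b _ => ?_
        rw [lintegral_indicator_const (hc b), ENNReal.ofReal_mul (by positivity),
          ofReal_measureReal]
    _ = ENNReal.ofReal (∑ b, |A (c x) b| ^ q * volume.real (c ⁻¹' {b})) :=
        (ENNReal.ofReal_sum_of_nonneg fun b _ => by positivity).symm
    _ ≤ _ := ENNReal.ofReal_le_ofReal (h _)

omit [Fintype ι] [DecidableEq ι] in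
theorem kernelSup_eq_one (h1 : ∀ a, A a a = 1) (h : ∀ a b, |A a b| ≤ 1) :
    kernelSup (fun x y : Cube d => A (c x) (c y)) = 1 := by
  apply le_antisymm
  · refine iSup₂_le fun x y => ?_
    rw [Real.enorm_eq_ofReal_abs, ← ENNReal.ofReal_one]
    exact ENNReal.ofReal_le_ofReal (h _ _)
  · let x : Cube d := fun _ => 0
    refine le_trans ?_ (le_iSup₂ x x)
    simp [h1]

/-- The expected maximum of `n` standard Gaussian variables is at most `t` as soon as
`n ≤ exp (t ^ 2 / 2)`. -/
theorem integral_iSup_multivariateGaussian_le [Nonempty ι] (hA : A.PosSemidef)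
    (h1 : ∀ a, A a a = 1) {t : ℝ} (ht : 0 < t)
    (hcard : (Fintype.card ι : ℝ) ≤ Real.exp (t ^ 2 / 2)) :
    Integrable (fun ω : EuclideanSpace ℝ ι => ⨆ a, ω a) (multivariateGaussian 0 A) ∧
      ∫ ω : EuclideanSpace ℝ ι, ⨆ a, ω a ∂(multivariateGaussian 0 A) ≤ t := by
  have hmeas : Measurable fun ω : EuclideanSpace ℝ ι => ⨆ a, ω a :=
    Measurable.iSup fun a => by fun_prop
  have hlaw (a : ι) : (multivariateGaussian 0 A).map (fun ω : EuclideanSpace ℝ ι => ω a)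
      = gaussianReal 0 1 := by
    have := (measurePreserving_eval_multivariateGaussian (μ := 0) hA (i := a)).map_eq
    simpa [h1] using this
  have hint : Integrable (fun ω : EuclideanSpace ℝ ι => ⨆ a, ω a) (multivariateGaussian 0 A) := by
    refine Integrable.mono' (integrable_finsetSum Finset.univ fun a _ =>
      ((memLp_eval_multivariateGaussian A a).integrable (by norm_num)).abs)
      hmeas.aestronglyMeasurable (ae_of_all _ fun ω => ?_)
    obtain ⟨a, ha⟩ := exists_eq_ciSup_of_finite (f := fun a => ω a)
    rw [← ha, Real.norm_eq_abs]
    exact Finset.single_le_sum (f := fun a => |ω a|) (fun _ _ => abs_nonneg _) (Finset.mem_univ a)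
  refine ⟨hint, ?_⟩
  have hexp (a : ι) : Integrable (fun ω : EuclideanSpace ℝ ι => Real.exp (t * ω a))
      (multivariateGaussian 0 A) := by
    have := integrable_exp_mul_gaussianReal (μ := 0) (v := 1) t
    rw [← hlaw a] at this
    exact this.comp_measurable (by fun_prop)
  have hmgf (a : ι) : ∫ ω : EuclideanSpace ℝ ι, Real.exp (t * ω a) ∂(multivariateGaussian 0 A) =
      Real.exp (t ^ 2 / 2) := by
    have := mgf_gaussianReal (hlaw a) t
    simpa [mgf] using this
  have hle : ∫ ω : EuclideanSpace ℝ ι, t * ⨆ a, ω a ∂(multivariateGaussian 0 A) ≤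
      ∫ ω : EuclideanSpace ℝ ι, (∑ a, Real.exp (-t ^ 2) * Real.exp (t * ω a)) + (t ^ 2 - 1)
        ∂(multivariateGaussian 0 A) := by
    refine integral_mono (hint.const_mul t) ((integrable_finsetSum _ fun a _ =>
      (hexp a).const_mul _).add (integrable_const _)) fun ω => ?_
    obtain ⟨a, ha⟩ := exists_eq_ciSup_of_finite (f := fun a => ω a)
    have h2 := Finset.single_le_sum (f := fun a => Real.exp (-t ^ 2) * Real.exp (t * ω a))
      (fun _ _ => by positivity) (Finset.mem_univ a)
    -- the tangent of the exponential function, for the Chernoff bound at level `t`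
    have h3 := Real.add_one_le_exp (-t ^ 2 + t * ω a)
    rw [Real.exp_add] at h3
    simp only [← ha]
    linarith
  rw [integral_const_mul, integral_add (integrable_finsetSum _ fun a _ => (hexp a).const_mul _)
    (integrable_const _), integral_finsetSum _ fun a _ => (hexp a).const_mul _] at hle
  simp only [integral_const_mul, hmgf, integral_const, probReal_univ, one_smul, Finset.sum_const,
    Finset.card_univ, nsmul_eq_mul] at hle
  have h4 : (Fintype.card ι : ℝ) * (Real.exp (-t ^ 2) * Real.exp (t ^ 2 / 2)) ≤ 1 := by
    calc _ ≤ Real.exp (t ^ 2 / 2) * (Real.exp (-t ^ 2) * Real.exp (t ^ 2 / 2)) := by gcongr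
      _ = 1 := by rw [← Real.exp_add, ← Real.exp_add, Real.exp_eq_one_iff]; ring
  nlinarith

theorem expectedSup_stepModel_le [Nonempty ι] (hs : Function.Surjective c) (hA : A.PosSemidef)
    (h1 : ∀ a, A a a = 1) {t : ℝ} (ht : 0 < t)
    (hcard : (Fintype.card ι : ℝ) ≤ Real.exp (t ^ 2 / 2)) :
    (stepModel c hc A).expectedSup ≤ ENNReal.ofReal t := by
  obtain ⟨hi, hle⟩ := integral_iSup_multivariateGaussian_le hA h1 ht hcard
  have e : (fun ω => ⨆ x, (stepModel c hc A).u x ω) =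
      fun ω : EuclideanSpace ℝ ι => ⨆ a, ω a := by
    have h (ω : EuclideanSpace ℝ ι) : ⨆ x, ω (c x) = ⨆ a, ω a := hs.iSup_comp (g := fun a => ω a)
    exact funext h
  have hb (ω : EuclideanSpace ℝ ι) : BddAbove (Set.range fun x => ω (c x)) :=
    (Set.finite_range fun a => ω a).bddAbove.mono (Set.range_comp_subset_range c fun a => ω a)
  rw [GaussianModel.expectedSup, e, if_pos ⟨ae_of_all _ hb, hi⟩]
  exact ENNReal.ofReal_le_ofReal hle

end StepModel

/-! ### The minimax risk in terms of the design -/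

section CrossSum

variable {R C : Type*} [Fintype R] [Fintype C] [DecidableEq R] [DecidableEq C]

/-- Weighted row sums of the correlation matrix, where the variable `none` has four times the weight
of the others: its own row sums to `4w`, and the others sum to at most `Kw`. -/
theorem sum_crossCov_mul_le {f : ℝ → ℝ} (hf0 : f 0 = 0) (hf1 : f 1 = 1) {Λ : R → C → ℝ} {w K : ℝ}
    (hw : 0 ≤ w) (hK : 4 ≤ K) (h : ∀ a, ∑ b, f (crossMatrix Λ a b) ≤ K - 1)
    (a : Option (R ⊕ C)) :
    ∑ b, f (crossCov Λ a b) * (if b = none then 4 * w else w) ≤ K * w := by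
  have h1 (b : Option (R ⊕ C)) : f (crossCov Λ a b) * (if b = none then 4 * w else w) =
      (if b = a then (if a = none then 4 * w else w) else 0) + f (crossMatrix Λ a b) * w := by
    by_cases hab : b = a
    · subst hab
      have : crossMatrix Λ b b = 0 := by rcases b with _ | b | b <;> rfl
      simp [crossCov, this, hf0, hf1]
    · rcases b with _ | b
      · have : crossMatrix Λ a none = 0 := by rcases a with _ | a | a <;> rfl
        simp [crossCov, Matrix.one_apply_ne (Ne.symm hab), hab, this, hf0]
      · simp [crossCov, Matrix.one_apply_ne (Ne.symm hab), hab]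
  simp only [h1, Finset.sum_add_distrib, Finset.sum_ite_eq', Finset.mem_univ, if_true,
    ← Finset.sum_mul]
  rcases a with _ | a
  · have : ∑ b, f (crossMatrix Λ none b) = 0 := sum_crossMatrix hf0 Λ none
    rw [this]
    simp only [if_true, zero_mul, add_zero]
    gcongr
  · have := mul_le_mul_of_nonneg_right (h (some a)) hw
    simp only [reduceCtorEq, if_false]
    linarith

omit [Fintype R] [Fintype C] in
theorem crossCov_self (Λ : R → C → ℝ) (a : Option (R ⊕ C)) : crossCov Λ a a = 1 := by
  rcases a with _ | a | a <;> simp [crossCov, crossMatrix]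

omit [Fintype R] [Fintype C] in
theorem abs_crossCov_le_one {Λ : R → C → ℝ} (h : ∀ i j, |Λ i j| ≤ 1) (a b : Option (R ⊕ C)) :
    |crossCov Λ a b| ≤ 1 := by
  by_cases hab : a = b
  · subst hab; rw [crossCov_self]; simp
  · rw [crossCov, Matrix.add_apply, Matrix.one_apply_ne hab, zero_add]
    rcases a with _ | a | a <;> rcases b with _ | b | b <;> simp [crossMatrix, h]

end CrossSum

section DesignModel

variable {d k B : ℕ}

/-- The process whose values on the cells have the correlations encoded by `γ` and `l`. -/
def designModel {c : Cube d → Option ((Fin k × Fin B) ⊕ (Fin k × Fin B))}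
    (hc : ∀ a, MeasurableSet (c ⁻¹' {a})) (τ : ℝ) (γ : Fin k × Fin B → Bool)
    (l : Fin k × Fin B → Fin k → Fin B) : GaussianModel d :=
  stepModel c hc (crossCov (designMatrix τ γ l))

variable {c : Cube d → Option ((Fin k × Fin B) ⊕ (Fin k × Fin B))}
  (hc : ∀ a, MeasurableSet (c ⁻¹' {a})) {w : ℝ} (hw : 0 < w)
  (hcw : ∀ a, volume.real (c ⁻¹' {a}) = if a = none then 4 * w else w)
  {τ : ℝ} (hτ : 0 < τ) (hkτ : 2 * k * τ ≤ 1 / 2) (γ : Fin k × Fin B → Bool)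
  {l : Fin k × Fin B → Fin k → Fin B} (hl : l ∈ balanced (Fin k × Fin B) k B)

include hw hcw hτ hkτ hl in
/-- The operator norm does not depend on the design: the distinguished cell is an eigenvector of
eigenvalue `4w`, and all weighted row sums are at most `4w`. -/
theorem norm_covOp_designModel : ‖(designModel hc τ γ l).covOp‖ = 4 * w := by
  have he := inner_cellVec hc
  simp only [hcw] at he
  have hA := posSemidef_crossCov_designMatrix hτ.le hkτ γ hl
  rw [designModel, covOp_stepModel hc hA]
  apply le_antisymm
  · refine norm_kernelSum_le he (fun a => by split_ifs <;> linarith)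
      (by simpa using! hA.isHermitian.eq) (by linarith) fun a => ?_
    refine sum_crossCov_mul_le (f := fun x => |x|) (by simp) (by simp) hw.le le_rfl (fun a => ?_) a
    exact (sum_abs_designMatrix_le hτ.le γ hl a).trans (by linarith)
  · have h1 := kernelSum_apply_self he (A := crossCov (designMatrix τ γ l)) (o := none) fun a => by
      rcases a with _ | a | a <;> simp [crossCov, crossMatrix]
    have h2 := (kernelSum (crossCov (designMatrix τ γ l)) (cellVec hc)).le_opNorm (cellVec hc none)
    rw [h1, norm_smul, if_pos rfl, Real.norm_of_nonneg (by linarith)] at h2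
    refine le_of_mul_le_mul_right h2 ?_
    have h3 := he none none
    rw [if_pos rfl, if_pos rfl, real_inner_self_eq_norm_sq] at h3
    have h4 : ‖cellVec hc none‖ ≠ 0 := sq_pos_iff.1 (by rw [h3]; linarith)
    exact h4.symm.lt_of_le (norm_nonneg _)

include hw hcw hτ hkτ hl in
theorem designModel_mem_sparseClass (hk : 0 < k) {q Γ₁ Γ₂ : ℝ} (hq : 0 < q) (hΓ₁ : 1 ≤ Γ₁)
    (hΓ₁k : 1 + 2 * k * τ ^ q ≤ 4 * Γ₁) (hΓ₂ : 0 < Γ₂)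
    (hcard : (2 * (k * B) + 1 : ℝ) ≤ Real.exp (Γ₂ ^ 2 / 2)) :
    designModel hc τ γ l ∈ sparseClass d q Γ₁ Γ₂ := by
  have hA := posSemidef_crossCov_designMatrix hτ.le hkτ γ hl
  have hnorm := norm_covOp_designModel hc hw hcw hτ hkτ γ hl
  have hk' : (1 : ℝ) ≤ k := by exact_mod_cast hk
  have hτ1 : τ ≤ 1 := by nlinarith
  have hker : (designModel hc τ γ l).kernel =
      fun x y => crossCov (designMatrix τ γ l) (c x) (c y) := by
    ext x y; exact kernel_stepModel hc hA x y
  have hsup : kernelSup (designModel hc τ γ l).kernel = 1 := by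
    rw [hker]
    refine kernelSup_eq_one (crossCov_self _) (abs_crossCov_le_one fun i j => ?_)
    unfold designMatrix
    split_ifs
    · unfold supportRow
      split_ifs <;> simp [abs_of_pos hτ, hτ1]
    · simp
  have hsurj : Function.Surjective c := fun a => by
    by_contra! h
    have h1 : c ⁻¹' {a} = ∅ := by
      ext x; simpa using h x
    have h2 := hcw a
    rw [h1, measureReal_empty] at h2
    split_ifs at h2 <;> linarith
  have hLq : kernelLq q (designModel hc τ γ l).kernel ≤ ENNReal.ofReal (4 * Γ₁ * w) := by
    rw [hker]
    refine kernelLq_le hc hq fun a => ?_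
    simp only [hcw]
    have hf0 : |(0 : ℝ)| ^ q = 0 := by simp [Real.zero_rpow hq.ne']
    have hfτ : |τ| ^ q = τ ^ q := by rw [abs_of_pos hτ]
    have hτq : 0 ≤ τ ^ q := by positivity
    have hkq : 0 ≤ k * τ ^ q := by positivity
    refine sum_crossCov_mul_le (f := fun x => |x| ^ q) hf0 (by simp) hw.le (by linarith)
      (fun a => ?_) a
    rw [sum_crossMatrix (f := fun x => |x| ^ q) hf0]
    rcases a with _ | i | j
    · simp only; linarith
    · have := sum_row_designMatrix_le (f := fun x => |x| ^ q) hf0 (hfτ ▸ hτq) γ l i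
      simp only [hfτ] at this ⊢
      linarith
    · have := sum_col_designMatrix_le (f := fun x => |x| ^ q) hf0 (hfτ ▸ hτq) γ hl j
      simp only [hfτ] at this ⊢
      linarith
  refine ⟨fun h0 => ?_, by simp [hsup], ?_, ?_⟩
  · rw [h0, norm_zero] at hnorm; linarith
  · rw [GaussianModel.sparsity, hsup, ENNReal.one_rpow, mul_one, ← ofReal_norm, hnorm]
    refine ENNReal.div_le_of_le_mul (hLq.trans_eq ?_)
    rw [← ENNReal.ofReal_mul (by linarith)]
    congr 1; ring
  · rw [GaussianModel.capacity, hsup, ENNReal.one_rpow, div_one]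
    refine expectedSup_stepModel_le hc hsurj hA (crossCov_self _) hΓ₂ ?_
    simpa [two_mul] using hcard

/-- Pairing the covariance operator with row `i` and the sum of all columns reads off the switch
`γ i`. -/
theorem inner_kernelSum_designMatrix
    {e : Option ((Fin k × Fin B) ⊕ (Fin k × Fin B)) → L2Cube d}
    (he : ∀ a b, inner ℝ (e a) (e b) = if a = b then (if a = none then 4 * w else w) else 0)
    (i : Fin k × Fin B) :
    inner ℝ (e (some (Sum.inl i)))
      (kernelSum (crossCov (designMatrix τ γ l)) e (∑ j, e (some (Sum.inr j)))) =
      if γ i then w ^ 2 * (k * τ) else 0 := by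
  rw [inner_kernelSum]
  have h1 (b : Option ((Fin k × Fin B) ⊕ (Fin k × Fin B))) :
      inner ℝ (e b) (∑ j, e (some (Sum.inr j))) = ∑ j, if b = some (Sum.inr j) then w else 0 := by
    rw [inner_sum]
    refine Finset.sum_congr rfl fun j _ => ?_
    rw [he]
    split_ifs with h h' <;> simp_all
  have h2 : ∑ j, designMatrix τ γ l i j = if γ i then k * τ else 0 := by
    unfold designMatrix
    split_ifs
    · exact sum_supportRow (f := id) rfl τ (l i)
    · simp
  have h3 (j : Fin k × Fin B) :
      crossCov (designMatrix τ γ l) (some (Sum.inl i)) (some (Sum.inr j)) =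
        designMatrix τ γ l i j := by
    simp [crossCov, crossMatrix]
  calc _ = ∑ j, crossCov (designMatrix τ γ l) (some (Sum.inl i)) (some (Sum.inr j)) * w * w := by
        rw [Finset.sum_eq_single (some (Sum.inl i))]
        · simp only [h1, he, Fintype.sum_option]
          simp
        · intro a _ ha
          simp [he, ha]
        · simp
    _ = _ := by
        simp only [h3, ← Finset.sum_mul, h2]
        split_ifs <;> ring

end DesignModel

/-- The lower bound in terms of the parameters of the construction: each row that is switched
on has `k` correlations of size `τ`, one in each of `k` blocks of `B` columns. -/
theorem ofReal_le_minimaxRisk (d : ℕ) (hd : 1 ≤ d) {k B : ℕ} (hk : 0 < k) (hB : 0 < B) {τ : ℝ}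
    (hτ : 0 < τ) (hkτ : 2 * k * τ ≤ 1 / 2) {q Γ₁ Γ₂ : ℝ} (hq : 0 < q) (hΓ₁ : 1 ≤ Γ₁)
    (hΓ₁k : 1 + 2 * k * τ ^ q ≤ 4 * Γ₁) (hΓ₂ : 0 < Γ₂)
    (hcard : (2 * (k * B) + 1 : ℝ) ≤ Real.exp (Γ₂ ^ 2 / 2)) (N : ℕ) :
    ENNReal.ofReal (3 * (k * τ) / (32 * Real.exp (2 * k / B * Real.exp (4 * N * τ ^ 2)))) ≤
      minimaxRisk N (sparseClass d q Γ₁ Γ₂) := by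
  set χ := Real.exp (2 * k / B * Real.exp (4 * N * τ ^ 2))
  have hχ : 0 < χ := Real.exp_pos _
  obtain ⟨c, hc, hcv⟩ := exists_cells d hd ((Fin k × Fin B) ⊕ (Fin k × Fin B))
  set w : ℝ := 1 / (Fintype.card ((Fin k × Fin B) ⊕ (Fin k × Fin B)) + 4 : ℕ) with hwd
  have hw : 0 < w := by positivity
  have hcw (a) : volume.real (c ⁻¹' {a}) = if a = none then 4 * w else w := by
    rw [measureReal_def, hcv, ENNReal.toReal_ofReal (by split_ifs <;> positivity)]
    rw [hwd]
    split_ifs <;> ring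
  have hmem (γ) {l} (hl : l ∈ balanced (Fin k × Fin B) k B) :
      designModel hc τ γ l ∈ sparseClass d q Γ₁ Γ₂ :=
    designModel_mem_sparseClass hc hw hcw hτ hkτ γ hl hk hq hΓ₁ hΓ₁k hΓ₂ hcard
  have he := inner_cellVec hc
  simp only [hcw] at he
  refine le_iInf₂ fun T hT => ?_
  let ψ : L2Cube d := ∑ j, cellVec hc (some (Sum.inr j))
  -- The data are the same function of the outcome in all models of the construction.
  let data : (Fin N → EuclideanSpace ℝ (Option ((Fin k × Fin B) ⊕ (Fin k × Fin B)))) →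
      Fin N → Cube d → ℝ := fun ω n x => ω n (c x)
  let v : Fin k × Fin B → (Fin N → EuclideanSpace ℝ (Option ((Fin k × Fin B) ⊕ (Fin k × Fin B)))) →
    ℝ := fun i ω => inner ℝ (cellVec hc (some (Sum.inl i))) (T (data ω) ψ)
  have hv : ∀ i γ, ∀ l ∈ balanced (Fin k × Fin B) k B, AEMeasurable (v i) (designLaw N τ γ l) :=
    fun i γ l hl =>
      ((innerSL ℝ (cellVec hc (some (Sum.inl i)))).continuous.comp_aestronglyMeasurable
        (hT _ (hmem γ hl) ψ)).aemeasurable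
  obtain ⟨γ, l, hl, hle⟩ := exists_le_sum_lintegral_designLaw hk hB hτ hkτ N
    (a := w ^ 2 * (k * τ)) (by positivity) hv
  refine le_trans ?_ (le_iSup₂ (designModel hc τ γ l) (hmem γ hl))
  set Cop := (designModel hc τ γ l).covOp
  have hCK : Cop = kernelSum (crossCov (designMatrix τ γ l)) (cellVec hc) :=
    covOp_stepModel hc (posSemidef_crossCov_designMatrix hτ.le hkτ γ hl)
  have hnorm : ‖Cop‖ = 4 * w := norm_covOp_designModel hc hw hcw hτ hkτ γ hl
  have hkB : (0 : ℝ) < k * B := by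
    have : (0 : ℝ) < k := by exact_mod_cast hk
    have : (0 : ℝ) < B := by exact_mod_cast hB
    positivity
  -- The errors in the switches add up to at most a multiple of the operator norm error.
  have hpt (ω) : ∑ i, ‖v i ω - if γ i then w ^ 2 * (k * τ) else 0‖ₑ ≤
      ENNReal.ofReal (k * B * w) * ‖T (data ω) - Cop‖ₑ := by
    have h1 := sum_abs_inner_le he (T (data ω) - Cop)
      (Finset.univ.map (Function.Embedding.inl.trans Function.Embedding.some))
      (Finset.univ.map (Function.Embedding.inr.trans Function.Embedding.some)) (w := k * B * w)
      (by simp) (by simp)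
    simp only [Finset.sum_map, Function.Embedding.trans_apply, Function.Embedding.inl_apply,
      Function.Embedding.inr_apply, Function.Embedding.some_apply] at h1
    have h2 (i) : inner ℝ (cellVec hc (some (Sum.inl i))) ((T (data ω) - Cop) ψ) =
        v i ω - if γ i then w ^ 2 * (k * τ) else 0 := by
      rw [sub_apply, inner_sub_right, hCK,
        inner_kernelSum_designMatrix γ he i]
    simp only [ψ] at h2
    simp only [h2] at h1
    simp only [Real.enorm_eq_ofReal_abs]
    rw [← ENNReal.ofReal_sum_of_nonneg fun _ _ => abs_nonneg _, ← ofReal_norm,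
      ← ENNReal.ofReal_mul (by positivity)]
    exact ENNReal.ofReal_le_ofReal h1
  have hint : ENNReal.ofReal (k * B * (3 * (w ^ 2 * (k * τ)) / (8 * χ))) ≤
      ENNReal.ofReal (k * B * w) * ∫⁻ ω, ‖T (data ω) - Cop‖ₑ ∂(designLaw N τ γ l) := by
    refine hle.trans ?_
    rw [← lintegral_finsetSum' _ fun i _ => ((hv i γ l hl).sub_const _).enorm,
      ← lintegral_const_mul' _ _ ENNReal.ofReal_ne_top]
    exact lintegral_mono hpt
  have hrisk : relativeRisk T (designModel hc τ γ l) =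
      (∫⁻ ω, ‖T (data ω) - Cop‖ₑ ∂(designLaw N τ γ l)) / ENNReal.ofReal (4 * w) := by
    rw [← hnorm, ofReal_norm]; rfl
  have hkBw : 0 < k * B * w := by positivity
  have e : k * B * (3 * (w ^ 2 * (k * τ)) / (8 * χ)) =
      k * B * w * (3 * (k * τ) / (32 * χ) * (4 * w)) := by
    field_simp; ring
  rw [e, ENNReal.ofReal_mul (p := k * B * w) hkBw.le,
    ENNReal.mul_le_mul_iff_right (ENNReal.ofReal_pos.2 hkBw).ne' ENNReal.ofReal_ne_top] at hint
  rw [hrisk, ENNReal.le_div_iff_mul_le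
    (Or.inl (ENNReal.ofReal_pos.2 (by linarith)).ne') (Or.inl ENNReal.ofReal_ne_top),
    ← ENNReal.ofReal_mul (by positivity)]
  exact hint

/-! ### Choice of the parameters -/

/-- The upper bound on `Γ₁` says that the rate is at most of order `Γ₂ ^ (-2)`. -/
theorem mul_rpow_div_sqrt_le {q M N Γ₁ Γ₂ : ℝ} (hN : 1 ≤ N) (hΓ₂ : 2 ≤ Γ₂)
    (h : Γ₁ ≤ M * N ^ ((1 - q) / 2) * Γ₂ ^ (-3 + q)) :
    Γ₁ * (Γ₂ / √N) ^ (1 - q) ≤ M / Γ₂ ^ 2 := by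
  have hN0 : 0 < N := by linarith
  have h0 : 0 < Γ₂ := by linarith
  have e1 : (Γ₂ / √N) ^ (1 - q) = Γ₂ ^ (1 - q) / N ^ ((1 - q) / 2) := by
    rw [Real.div_rpow h0.le (Real.sqrt_nonneg _), Real.sqrt_eq_rpow, ← Real.rpow_mul hN0.le]
    ring_nf
  have e2 : Γ₂ ^ (-3 + q) * Γ₂ ^ (1 - q) = (Γ₂ ^ 2)⁻¹ := by
    rw [← Real.rpow_add h0, ← Real.rpow_natCast, ← Real.rpow_neg h0.le]
    norm_num
  have hNq : 0 < N ^ ((1 - q) / 2) := Real.rpow_pos_of_pos hN0 _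
  calc Γ₁ * (Γ₂ / √N) ^ (1 - q)
      ≤ M * N ^ ((1 - q) / 2) * Γ₂ ^ (-3 + q) * (Γ₂ / √N) ^ (1 - q) := by
        gcongr
    _ = M * (Γ₂ ^ (-3 + q) * Γ₂ ^ (1 - q)) := by rw [e1]; field_simp
    _ = _ := by rw [e2]; ring

/-- The constraints bound `Γ₂ / √N`: if it exceeds `1`, the rate does so as well, so that
`Γ₂ ^ 2 ≤ M`. -/
theorem div_sqrt_le_max {q M N Γ₁ Γ₂ : ℝ} (hq1 : q ≤ 1) (hN : 1 ≤ N) (hΓ₂ : 2 ≤ Γ₂)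
    (hΓ₁ : 1 ≤ Γ₁) (h : Γ₁ ≤ M * N ^ ((1 - q) / 2) * Γ₂ ^ (-3 + q)) :
    Γ₂ / √N ≤ max 1 M := by
  rcases le_total (Γ₂ / √N) 1 with h1 | h1
  · exact h1.trans (le_max_left _ _)
  have hA := mul_rpow_div_sqrt_le hN hΓ₂ h
  -- `1 ≤ M / Γ₂ ^ 2`, hence `Γ₂ / √N ≤ Γ₂ ≤ M`.
  have h2 : 1 ≤ (Γ₂ / √N) ^ (1 - q) := Real.one_le_rpow h1 (by linarith)
  have h3 : 1 ≤ M / Γ₂ ^ 2 := by nlinarith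
  rw [one_le_div (by positivity)] at h3
  have h4 : Γ₂ / √N ≤ Γ₂ := div_le_self (by linarith) (Real.one_le_sqrt.2 hN)
  refine le_trans ?_ (le_max_right _ _)
  nlinarith

/-- The block size `B` is of order `P / k`, so that at most `P` cells are used. If
`k ^ 2 ≤ N ≤ (P - 1) ^ (1 - δ)`, then `k ^ 2 * P ^ δ` is of order `P` at most, and the exponent
`(2k / B) E` of the chi-square bound stays bounded for `E ≤ G ^ δ`, where `G` stands for
`exp (Γ₂ ^ 2 / 2)` and `P` for its integer part. -/
theorem exists_blockSize {k P : ℕ} {N δ G E : ℝ} (hk : 0 < k) (hkN : (k : ℝ) ^ 2 ≤ N) (hδ0 : 0 ≤ δ)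
    (hδ1 : δ ≤ 1) (hP : 5 ≤ P) (hNP : N ≤ ((P : ℝ) - 1) ^ (1 - δ)) (hG0 : 0 ≤ G) (hG : G ≤ P + 1)
    (hE : E ≤ G ^ δ) :
    ∃ B : ℕ, 0 < B ∧ 2 * (k * B) + 1 ≤ P ∧ 2 * k / B * E ≤ 16 := by
  set p := P - 1 with hp
  have hpP : (P : ℝ) - 1 = p := by rw [hp]; push_cast [show 1 ≤ P by omega]; ring
  have hp4 : (4 : ℝ) ≤ p := by
    have : 4 ≤ p := by omega
    exact_mod_cast this
  rw [hpP] at hNP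
  have hp0 : (0 : ℝ) < p := by linarith
  have hk0 : (0 : ℝ) < k := by exact_mod_cast hk
  have hNp : N ≤ p := hNP.trans (by
    calc (p : ℝ) ^ (1 - δ) ≤ (p : ℝ) ^ (1 : ℝ) := by gcongr <;> linarith
      _ = p := Real.rpow_one _)
  have h2k : 2 * k ≤ p := by
    have : (2 * k : ℝ) ≤ p := by
      refine abs_le_of_sq_le_sq' ?_ hp0.le |>.2
      nlinarith
    exact_mod_cast this
  have hB : 0 < p / (2 * k) := Nat.div_pos h2k (by omega)
  refine ⟨p / (2 * k), hB, ?_, ?_⟩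
  · have := Nat.mul_div_le p (2 * k)
    rw [mul_assoc] at this
    omega
  set B := p / (2 * k)
  have hB0 : (0 : ℝ) < B := by exact_mod_cast hB
  have hpB : (p : ℝ) ≤ 4 * k * B := by
    have h1 : p < 2 * k * (B + 1) := Nat.lt_mul_div_succ p (by omega)
    have h2 : 2 * k * (B + 1) ≤ 4 * k * B := by nlinarith
    exact_mod_cast h1.le.trans h2
  have hGp : G ≤ 2 * p := by linarith
  have hGδ : G ^ δ ≤ 2 * (p : ℝ) ^ δ := by
    calc G ^ δ ≤ (2 * p : ℝ) ^ δ := by gcongr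
      _ = 2 ^ δ * (p : ℝ) ^ δ := Real.mul_rpow (by norm_num) hp0.le
      _ ≤ 2 ^ (1 : ℝ) * (p : ℝ) ^ δ := by gcongr; norm_num
      _ = _ := by rw [Real.rpow_one]
  have hpp : (p : ℝ) ^ (1 - δ) * (p : ℝ) ^ δ = p := by
    rw [← Real.rpow_add hp0]; simp
  have hNE : k ^ 2 * E ≤ 2 * p := by
    calc k ^ 2 * E ≤ k ^ 2 * (2 * (p : ℝ) ^ δ) := by gcongr; exact hE.trans hGδ
      _ ≤ (p : ℝ) ^ (1 - δ) * (2 * (p : ℝ) ^ δ) := by gcongr; exact hkN.trans hNP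
      _ = _ := by rw [mul_left_comm, hpp]
  rw [div_mul_eq_mul_div, div_le_iff₀ hB0]
  refine le_of_mul_le_mul_left ?_ hk0
  nlinarith

/-- A row of `k` correlations of size `υ * s`, where `s` plays the part of `Γ₂ / √N`: the `q`-th
powers add up to at most `Γ₁`, while the row sum is at least of order `Γ₁ * s ^ (1 - q)`. -/
theorem exists_rowLength {q C Γ₁ Γ₂ N s υ : ℝ} (hq : 0 < q) (hC : 1 ≤ C) (hN : 1 ≤ N)
    (hΓ₁ : 1 ≤ Γ₁) (hΓ₂ : 2 ≤ Γ₂) (hs : 0 < s) (hsΓ : s * √N = Γ₂)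
    (hA : Γ₁ * s ^ (1 - q) ≤ C / Γ₂ ^ 2) (hυ : 0 < υ) (hυ1 : υ ≤ 1) (hυs : υ * s ≤ 1 / 4) :
    ∃ k : ℕ, 0 < k ∧ (k : ℝ) ^ 2 ≤ N ∧ k * (υ * s) ≤ 1 / 4 ∧ k * (υ * s) ^ q ≤ Γ₁ ∧
      Γ₁ * s ^ (1 - q) ≤ 2 * C * (k * s) := by
  have hC0 : 0 < C := by linarith
  have hsN : 1 ≤ √N := Real.one_le_sqrt.2 hN
  have hss : s ^ (1 - q) = s * s ^ (-q) := by
    rw [show (1 - q) = 1 + -q by ring, Real.rpow_add hs, Real.rpow_one]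
  -- `k` is the integer part of `x`, but at least `1`.
  set x := Γ₁ * s ^ (-q) / C with hx
  have hx0 : 0 < x := by positivity
  have hxs : Γ₁ * s ^ (1 - q) = C * (x * s) := by rw [hss, hx]; field_simp
  have hxs1 : x * s ≤ 1 / Γ₂ ^ 2 := by
    refine le_of_mul_le_mul_left ?_ hC0
    rw [← hxs]
    exact hA.trans_eq (by ring)
  have hΓ4 : (4 : ℝ) ≤ Γ₂ ^ 2 := by nlinarith
  have hxs2 : x * s ≤ 1 / 4 := hxs1.trans (by gcongr)
  have hxN : x ≤ √N := by
    refine le_of_mul_le_mul_right ?_ hs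
    rw [mul_comm (√N), hsΓ]
    linarith
  have hxq : x * (υ * s) ^ q ≤ Γ₁ := by
    have e : s ^ (-q) * s ^ q = 1 := by rw [← Real.rpow_add hs]; simp
    have e2 : x * (υ * s) ^ q = Γ₁ * (υ ^ q / C) := by
      rw [Real.mul_rpow hυ.le hs.le, hx]
      calc _ = Γ₁ * (υ ^ q / C) * (s ^ (-q) * s ^ q) := by ring
        _ = _ := by rw [e, mul_one]
    rw [e2]
    have h1 : υ ^ q ≤ 1 := Real.rpow_le_one hυ.le hυ1 hq.le
    have h2 : υ ^ q / C ≤ 1 := (div_le_one hC0).2 (h1.trans hC)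
    exact mul_le_of_le_one_right (by linarith) h2
  have hτq : (υ * s) ^ q ≤ 1 := Real.rpow_le_one (by positivity) (by linarith) hq.le
  have hkx : ((max 1 ⌊x⌋₊ : ℕ) : ℝ) ≤ max 1 x := by
    rw [Nat.cast_max, Nat.cast_one]
    exact max_le_max le_rfl (Nat.floor_le hx0.le)
  have hmax (y z : ℝ) (hy : 0 ≤ y) (h1 : y ≤ z) (h2 : x * y ≤ z) :
      ((max 1 ⌊x⌋₊ : ℕ) : ℝ) * y ≤ z := by
    refine (mul_le_mul_of_nonneg_right hkx hy).trans ?_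
    rcases max_choice 1 x with h | h <;> rw [h]
    · linarith
    · exact h2
  refine ⟨max 1 ⌊x⌋₊, by omega, ?_, hmax _ _ (by positivity) hυs ?_,
    hmax _ _ (by positivity) (hτq.trans hΓ₁) hxq, ?_⟩
  · rw [← Real.sq_sqrt (by linarith : 0 ≤ N)]
    gcongr
    exact hkx.trans (max_le hsN hxN)
  · calc x * (υ * s) = υ * (x * s) := by ring
      _ ≤ 1 * (1 / 4) := by gcongr
      _ = _ := one_mul _
  · have h1 : x < ⌊x⌋₊ + 1 := Nat.lt_floor_add_one x
    have h2 : (⌊x⌋₊ : ℝ) ≤ (max 1 ⌊x⌋₊ : ℕ) := by exact_mod_cast le_max_right _ _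
    have h3 : (1 : ℝ) ≤ (max 1 ⌊x⌋₊ : ℕ) := by exact_mod_cast le_max_left _ _
    have h4 : x ≤ 2 * (max 1 ⌊x⌋₊ : ℕ) := by linarith
    calc Γ₁ * s ^ (1 - q) = C * (x * s) := hxs
      _ ≤ C * (2 * (max 1 ⌊x⌋₊ : ℕ) * s) := by gcongr
      _ = _ := by ring

/-- The parameters of the construction: correlations `τ` of order `Γ₂ / √N`, and rows of about
`Γ₁ * τ ^ (-q)` correlations. -/
theorem exists_design_parameters {q : ℝ} (hq : 0 < q) (hq1 : q ≤ 1) {β : ℝ} (hβ : 1 < β) {M : ℝ} :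
    ∃ c : ℝ, 0 < c ∧ ∀ (N : ℕ) (Γ₁ Γ₂ : ℝ),
      1 ≤ (N : ℝ) ^ β →
      (N : ℝ) ^ β ≤ (⌊Real.exp (Γ₂ ^ 2 / 2)⌋₊ : ℝ) - 1 →
      2 ≤ Γ₂ →
      1 ≤ Γ₁ →
      Γ₁ ≤ M * (N : ℝ) ^ ((1 - q) / 2) * Γ₂ ^ (-3 + q) →
      ∃ (k B : ℕ) (τ : ℝ), 0 < k ∧ 0 < B ∧ 0 < τ ∧ 2 * k * τ ≤ 1 / 2 ∧
        1 + 2 * k * τ ^ q ≤ 4 * Γ₁ ∧ (2 * (k * B) + 1 : ℝ) ≤ Real.exp (Γ₂ ^ 2 / 2) ∧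
        2 * k / B * Real.exp (4 * N * τ ^ 2) ≤ 16 ∧
        c * (Γ₁ * (Γ₂ / √N) ^ (1 - q)) ≤ k * τ := by
  set C := max 1 M
  have hC1 : 1 ≤ C := le_max_left _ _
  have hCM : M ≤ C := le_max_right _ _
  have hβ0 : 0 < β := by linarith
  -- `N ≤ exp (Γ₂ ^ 2 / 2) ^ (1 - δ)` leaves room for `exp (4 * N * τ ^ 2) ≤ exp (Γ₂ ^ 2 / 2) ^ δ`
  -- in the chi-square bound.
  set δ := 1 - 1 / β with hδ
  have hδ0 : 0 < δ := by
    have : 1 / β < 1 := (div_lt_one hβ0).2 hβ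
    linarith
  have hδ1 : δ ≤ 1 := by
    have : 0 ≤ 1 / β := by positivity
    linarith
  -- `τ = υ * s` with `s = Γ₂ / √N ≤ C`; this `υ` makes `τ` and `4 * N * τ ^ 2` small enough.
  set υ := δ / (8 * C) with hυ
  have hυ0 : 0 < υ := by positivity
  have hυC : υ * C = δ / 8 := by rw [hυ]; field_simp
  have hυδ : υ ≤ δ / 8 := hυC ▸ le_mul_of_one_le_right hυ0.le hC1
  refine ⟨υ / (2 * C), by positivity, fun N Γ₁ Γ₂ hN1 hNP hΓ₂ hΓ₁ hΓ => ?_⟩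
  have hN : 1 ≤ N := by
    rcases Nat.eq_zero_or_pos N with rfl | h
    · rw [Nat.cast_zero, Real.zero_rpow hβ0.ne'] at hN1; linarith
    · exact h
  have hNr : (1 : ℝ) ≤ N := by exact_mod_cast hN
  have hN0 : (0 : ℝ) < N := by linarith
  have hA := (mul_rpow_div_sqrt_le hNr hΓ₂ hΓ).trans
    (div_le_div_of_nonneg_right hCM (sq_nonneg Γ₂))
  have hsC := div_sqrt_le_max hq1 hNr hΓ₂ hΓ₁ hΓ
  set s := Γ₂ / √(N : ℝ) with hs
  have hs0 : 0 < s := by positivity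
  have hsΓ : s * √(N : ℝ) = Γ₂ := by rw [hs]; field_simp
  have hτ8 : υ * s ≤ 1 / 4 := by
    calc υ * s ≤ υ * C := by gcongr
      _ ≤ 1 / 4 := by rw [hυC]; linarith
  obtain ⟨k, hk, hkN, hkτ, hkτq, hle⟩ :=
    exists_rowLength hq hC1 hNr hΓ₁ hΓ₂ hs0 hsΓ hA hυ0 (by linarith) hτ8
  have hP5 : 5 ≤ ⌊Real.exp (Γ₂ ^ 2 / 2)⌋₊ := by
    refine Nat.le_floor ?_
    have h1 : Real.exp 2 ≤ Real.exp (Γ₂ ^ 2 / 2) := Real.exp_le_exp.2 (by nlinarith)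
    have h2 : Real.exp 2 = Real.exp 1 * Real.exp 1 := by rw [← Real.exp_add]; norm_num
    have h3 : 2.7 * 2.7 ≤ Real.exp 1 * Real.exp 1 := by
      have := Real.exp_one_gt_d9
      gcongr <;> linarith
    refine le_trans ?_ (h3.trans (h2 ▸ h1))
    norm_num
  have hNδ : (N : ℝ) ≤ ((⌊Real.exp (Γ₂ ^ 2 / 2)⌋₊ : ℝ) - 1) ^ (1 - δ) := by
    have : 1 - δ = β⁻¹ := by rw [hδ]; ring
    rw [this, ← Real.rpow_rpow_inv hN0.le hβ0.ne']
    gcongr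
  have hE : Real.exp (4 * N * (υ * s) ^ 2) ≤ Real.exp (Γ₂ ^ 2 / 2) ^ δ := by
    rw [← Real.exp_mul]
    apply Real.exp_le_exp.2
    have e1 : 4 * N * (υ * s) ^ 2 = 8 * υ ^ 2 * (Γ₂ ^ 2 / 2) := by
      rw [← hsΓ, mul_pow, mul_pow, Real.sq_sqrt hN0.le]; ring
    have e2 : 8 * υ ^ 2 ≤ δ := by nlinarith
    rw [e1, mul_comm _ δ]
    gcongr
  obtain ⟨B, hB, hBP, hBE⟩ := exists_blockSize hk hkN hδ0.le hδ1 hP5 hNδ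
    (Real.exp_nonneg _) (Nat.lt_floor_add_one _).le hE
  refine ⟨k, B, υ * s, hk, hB, by positivity, by linarith, by linarith, ?_, hBE, ?_⟩
  · have h1 : ((2 * (k * B) + 1 : ℕ) : ℝ) ≤ ⌊Real.exp (Γ₂ ^ 2 / 2)⌋₊ := by exact_mod_cast hBP
    push_cast at h1
    exact h1.trans (Nat.floor_le (Real.exp_nonneg _))
  · calc υ / (2 * C) * (Γ₁ * s ^ (1 - q)) ≤ υ / (2 * C) * (2 * C * (k * s)) := by gcongr
      _ = k * (υ * s) := by field_simp

end

theorem mainTheorem3 (d : ℕ) (hd : 1 ≤ d) (q : ℝ) (hq : 0 < q) (hq1 : q ≤ 1)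
    (β : ℝ) (hβ : 1 < β) (M : ℝ) (hM : 0 < M) :
    ∃ c : ℝ, 0 < c ∧ ∀ (N : ℕ) (Γ₁ Γ₂ : ℝ),
      1 ≤ (N : ℝ) ^ β →
      (N : ℝ) ^ β ≤ (⌊Real.exp (Γ₂ ^ 2 / 2)⌋₊ : ℝ) - 1 →
      2 ≤ Γ₂ →
      1 ≤ Γ₁ →
      Γ₁ ≤ M * (N : ℝ) ^ ((1 - q) / 2) * Γ₂ ^ (-3 + q) →
      ENNReal.ofReal (c * (Γ₁ * (Γ₂ / Real.sqrt N) ^ (1 - q))) ≤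
        minimaxRisk N (sparseClass d q Γ₁ Γ₂) := by
  obtain ⟨c, hc, h⟩ := exists_design_parameters hq hq1 hβ (M := M)
  refine ⟨3 * c / (32 * Real.exp 16), by positivity, fun N Γ₁ Γ₂ hN hNP hΓ₂ hΓ₁ hΓ => ?_⟩
  obtain ⟨k, B, τ, hk, hB, hτ, hkτ, hkq, hcard, hE, hle⟩ := h N Γ₁ Γ₂ hN hNP hΓ₂ hΓ₁ hΓ
  refine le_trans (ENNReal.ofReal_le_ofReal ?_)
    (ofReal_le_minimaxRisk d hd hk hB hτ hkτ hq hΓ₁ hkq (by linarith) hcard N)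
  calc 3 * c / (32 * Real.exp 16) * (Γ₁ * (Γ₂ / √N) ^ (1 - q))
      = 3 * (c * (Γ₁ * (Γ₂ / √N) ^ (1 - q))) / (32 * Real.exp 16) := by ring
    _ ≤ 3 * (k * τ) / (32 * Real.exp (2 * k / B * Real.exp (4 * N * τ ^ 2))) := by gcongr
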